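/- Let $k$ be a field and $D(k)$ its (unbounded) derived category. Let $M=\{1,m\}$ be the monoid with identity $1$ and $m^2=m$, and let $T_M=D(k_1)\oplus D(k_m)$ with $k_1=k_m=k$: the objects are pairs $X=(X_1,X_m)$ of objects of $D(k)$, and morphisms, the shift and distinguished triangles are componentwise. Give $T_M$ the symmetric monoidal structure determined by $M$, $$(X\otimes Y)_1=X_1\otimes_k Y_1,\qquad (X\otimes Y)_m=(X_1\otimes_k Y_m)\oplus(X_m\otimes_k Y_1)\oplus(X_m\otimes_k Y_m).$$ Write $k_1$ and $k_m$ also for the objects $(k,0)$ and $(0,k)$; then $k_1$ is the unit object and $k_m\otimes k_m\cong k_m$. The Bousfield class of an object $X$ is $A(X)=\{Y : X\otimes Y=0\}$, and the Bousfield lattice is the collection of all Bousfield classes, ordered by reverse inclusion. A localizing subcategory is a full triangulated subcategory closed under isomorphisms and small coproducts; $\mathrm{loc}(X)$ is the smallest one containing $X$; a localizing $\otimes$-ideal is one closed under tensoring with arbitrary objects. An object $X$ is compact if $\mathrm{Hom}(X,-)$ preserves small coproducts, and rigid if it has a dual for $\otimes$. A triangulated category is compactly generated if it has small coproducts and a set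 $\mathcal G$ of compact objects such that every $X$ with $\mathrm{Hom}(G,X[n])=0$ for all $G\in\mathcal G$, $n\in\mathbb Z$ is zero; a compactly generated category with a tensor product is rigidly compactly generated if its compact objects contain the unit, are closed under $\otimes$, and all have duals that are compact. A localization away from a localizing subcategory $S$ is a functor $L$ with a natural transformation $\eta:\mathrm{id}\to L$ such that for every $X$ there is a distinguished triangle $F\to X\xrightarrow{\eta_X} LX\to F[1]$ with $F\in S$, and $\mathrm{Hom}(Y,LX)=0$ for all $Y\in S$; it is smashing if $L$ preserves small coproducts. Then the following hold. 1. The Bousfield lattice of $T_M$ is the two-element lattice consisting of $A(0)\neq A(k_1)$. 2. $\mathrm{loc}(k_m)$ is a nonzero, proper localizing $\otimes$-ideal of $T_M$, and there is no object $X$ of $T_M$ with $\mathrm{loc}(k_m)=A(X)$. 3. $T_M$ is compactly generated but not rigidly compactly generated: some compact object of $T_M$ is not rigid. 4. The object $k_m$ is compact; a localization away from $\mathrm{loc}(k_m)$ exists, and every such localization $(L,\eta)$ is smashing. The functor $L$ is the projection onto the component $D(k_1)$, that is, $(\eta_X)_1$ is an isomorphism and $(LX)_m=0$ for every $X$. There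 is no object $E$ of $T_M$ (in particular no tensor idempotent) with $L\cong E\otimes(-)$. -/

import Mathlib

/-! # Two copies of the derived category of a field, with a tensor product from a monoid -/
open CategoryTheory Limits MonoidalCategory
open scoped ZeroObject
universe w u

/-! ### The Koszul braiding on complexes of vector spaces -/

namespace KoszulBraiding
open HomologicalComplex ComplexShape

variable {k : Type u} [Field k] (K L P : CochainComplex (ModuleCat.{u} k) ℤ)

/-- The degree `n` part of the braiding: `x ⊗ y` goes to `(-1)^(i * j) • (y ⊗ x)` for `x`, `y` of
degrees `i`, `j`. -/
noncomputable def homF (n : ℤ) : (K ⊗ L).X n ⟶ (L ⊗ K).X n :=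
  mapBifunctorDesc (K₁ := K) (K₂ := L) (F := curriedTensor (ModuleCat.{u} k)) (c := ComplexShape.up ℤ)
    (fun i j h => (i * j).negOnePow • ((β_ (K.X i) (L.X j)).hom ≫
      ιTensorObj L K j i n (by rw [add_comm]; exact h)))

lemma ι_homF (i j n : ℤ) (h : i + j = n) :
    ιTensorObj K L i j n h ≫ homF K L n =
      (i * j).negOnePow • ((β_ (K.X i) (L.X j)).hom ≫
        ιTensorObj L K j i n (by rw [add_comm]; exact h)) := by
  unfold homF
  exact ι_mapBifunctorDesc _ _ _ _

lemma ι_d (i j n n' : ℤ) (h : i + j = n) (h' : n + 1 = n') :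
    ιTensorObj K L i j n h ≫ (K ⊗ L).d n n' =
      (K.d i (i + 1) ▷ L.X j) ≫ ιTensorObj K L (i + 1) j n' (by omega) +
      i.negOnePow • ((K.X i ◁ L.d j (j + 1)) ≫ ιTensorObj K L i (j + 1) n' (by omega)) := by
  have e : (K ⊗ L).d n n' = mapBifunctor.D₁ K L (curriedTensor _) (up ℤ) n n' +
    mapBifunctor.D₂ K L (curriedTensor _) (up ℤ) n n' := rfl
  rw [e, Preadditive.comp_add]
  erw [mapBifunctor.ι_D₁, mapBifunctor.ι_D₂]
  rw [mapBifunctor.d₁_eq K L (curriedTensor _) (up ℤ) (i₁ := i) (i₁' := i + 1) (by simp) j n' (show i + 1 + j = n' by omega),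
    mapBifunctor.d₂_eq K L (curriedTensor _) (up ℤ) i (i₂ := j) (i₂' := j + 1) (by simp) n' (show i + (j + 1) = n' by omega)]
  have h1 : ε₁ (up ℤ) (up ℤ) (up ℤ) (i, j) = 1 := rfl
  have h2 : ε₂ (up ℤ) (up ℤ) (up ℤ) (i, j) = i.negOnePow := rfl
  rw [h1, h2, one_smul]
  rfl

lemma homF_comm (n n' : ℤ) (h' : n + 1 = n') :
    homF K L n ≫ (L ⊗ K).d n n' = (K ⊗ L).d n n' ≫ homF K L n' := by
  refine HomologicalComplex.mapBifunctor.hom_ext (fun i j h => ?_)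
  change i + j = n at h
  change ιTensorObj K L i j n h ≫ _ = ιTensorObj K L i j n h ≫ _
  rw [← Category.assoc, ι_homF, ← Category.assoc, ι_d K L i j n n' h h']
  simp only [Linear.units_smul_comp, Category.assoc, Preadditive.add_comp, ι_homF,
    ι_d L K j i n n' _ h', Linear.comp_units_smul, Preadditive.comp_add, smul_add, smul_smul,
    BraidedCategory.braiding_naturality_right_assoc, BraidedCategory.braiding_naturality_left_assoc]
  rw [add_comm]
  congr 2
  · rw [add_mul, one_mul, Int.negOnePow_add]
  · rw [mul_add, mul_one, Int.negOnePow_add, ← mul_assoc, mul_comm (Int.negOnePow i), mul_assoc]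
    simp

lemma homF_homF (n : ℤ) : homF K L n ≫ homF L K n = 𝟙 _ := by
  refine HomologicalComplex.mapBifunctor.hom_ext (fun i j h => ?_)
  change i + j = n at h
  change ιTensorObj K L i j n h ≫ _ = ιTensorObj K L i j n h ≫ _
  rw [← Category.assoc, ι_homF]
  simp only [Linear.units_smul_comp, Category.assoc, ι_homF, Linear.comp_units_smul, smul_smul,
    SymmetricCategory.symmetry_assoc, mul_comm j i, Int.units_mul_self, one_smul]
  exact (Category.comp_id _).symm

/-- The Koszul braiding. -/
noncomputable def braiding : K ⊗ L ≅ L ⊗ K where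
  hom := { f := homF K L, comm' := fun n n' h => homF_comm K L n n' h }
  inv := { f := homF L K, comm' := fun n n' h => homF_comm L K n n' h }
  hom_inv_id := by ext1 n; exact homF_homF K L n
  inv_hom_id := by ext1 n; exact homF_homF L K n

variable {K L P} in
lemma ι_whiskerRight {K' : CochainComplex (ModuleCat.{u} k) ℤ} (f : K ⟶ K') (i j n : ℤ)
    (h : i + j = n) :
    ιTensorObj K L i j n h ≫ (f ▷ L).f n = (f.f i ▷ L.X j) ≫ ιTensorObj K' L i j n h := by
  refine (ι_mapBifunctorMap _ _ _ _ _ _ _ _).trans ?_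
  simp

variable {K L P} in
lemma ι_whiskerLeft {L' : CochainComplex (ModuleCat.{u} k) ℤ} (f : L ⟶ L') (i j n : ℤ)
    (h : i + j = n) :
    ιTensorObj K L i j n h ≫ (K ◁ f).f n = (K.X i ◁ f.f j) ≫ ιTensorObj K L' i j n h := by
  refine (ι_mapBifunctorMap _ _ _ _ _ _ _ _).trans ?_
  simp

lemma ι_braiding (i j n : ℤ) (h : i + j = n) :
    ιTensorObj K L i j n h ≫ (braiding K L).hom.f n =
      (i * j).negOnePow • ((β_ (K.X i) (L.X j)).hom ≫
        ιTensorObj L K j i n (by rw [add_comm]; exact h)) :=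
  ι_homF K L i j n h

lemma hom_ext' {A : ModuleCat.{u} k} {n : ℤ} {f g : (K ⊗ L).X n ⟶ A}
    (H : ∀ i j (h : i + j = n), ιTensorObj K L i j n h ≫ f = ιTensorObj K L i j n h ≫ g) : f = g :=
  HomologicalComplex.mapBifunctor.hom_ext (fun i j h => H i j h)

lemma braiding_naturality_right {L L' : CochainComplex (ModuleCat.{u} k) ℤ} (f : L ⟶ L') :
    K ◁ f ≫ (braiding K L').hom = (braiding K L).hom ≫ f ▷ K := by
  ext1 n
  refine hom_ext' _ _ (fun i j h => ?_)
  rw [HomologicalComplex.comp_f, HomologicalComplex.comp_f, ← Category.assoc, ← Category.assoc,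
    ι_whiskerLeft, ι_braiding, Category.assoc, ι_braiding]
  simp only [Linear.units_smul_comp, Category.assoc, ι_whiskerRight, Linear.comp_units_smul,
    BraidedCategory.braiding_naturality_right_assoc]

lemma braiding_naturality_left {K K' : CochainComplex (ModuleCat.{u} k) ℤ} (f : K ⟶ K') :
    f ▷ L ≫ (braiding K' L).hom = (braiding K L).hom ≫ L ◁ f := by
  ext1 n
  refine hom_ext' _ _ (fun i j h => ?_)
  rw [HomologicalComplex.comp_f, HomologicalComplex.comp_f, ← Category.assoc, ← Category.assoc,
    ι_whiskerRight, ι_braiding, Category.assoc, ι_braiding]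
  simp only [Linear.units_smul_comp, Category.assoc, ι_whiskerLeft, Linear.comp_units_smul,
    BraidedCategory.braiding_naturality_left_assoc]

/-- The inclusion of a summand of a triple tensor product. -/
noncomputable def ι₃ (i₁ i₂ i₃ j i₂₃ : ℤ) (h₂₃ : i₂ + i₃ = i₂₃) (h : i₁ + i₂₃ = j) :
    K.X i₁ ⊗ L.X i₂ ⊗ P.X i₃ ⟶ (K ⊗ L ⊗ P).X j :=
  (K.X i₁ ◁ ιTensorObj L P i₂ i₃ i₂₃ h₂₃) ≫ ιTensorObj K (L ⊗ P) i₁ i₂₃ j h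

/-- The inclusion of a summand of a triple tensor product, bracketed the other way. -/
noncomputable def ι₃' (i₁ i₂ i₃ j i₁₂ : ℤ) (h₁₂ : i₁ + i₂ = i₁₂) (h : i₁₂ + i₃ = j) :
    (K.X i₁ ⊗ L.X i₂) ⊗ P.X i₃ ⟶ ((K ⊗ L) ⊗ P).X j :=
  (ιTensorObj K L i₁ i₂ i₁₂ h₁₂ ▷ P.X i₃) ≫ ιTensorObj (K ⊗ L) P i₁₂ i₃ j h

lemma ι₃'_associator (i₁ i₂ i₃ j i₁₂ i₂₃ : ℤ) (h₁₂ : i₁ + i₂ = i₁₂) (h : i₁₂ + i₃ = j)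
    (h₂₃ : i₂ + i₃ = i₂₃) (h' : i₁ + i₂₃ = j) :
    ι₃' K L P i₁ i₂ i₃ j i₁₂ h₁₂ h ≫ (α_ K L P).hom.f j =
      (α_ _ _ _).hom ≫ ι₃ K L P i₁ i₂ i₃ j i₂₃ h₂₃ h' := by
  subst h₁₂ h₂₃
  exact GradedObject.Monoidal.ιTensorObj₃'_associator_hom K.X L.X P.X i₁ i₂ i₃ j h

lemma hom_ext₃' {A : ModuleCat.{u} k} {n : ℤ} {f g : ((K ⊗ L) ⊗ P).X n ⟶ A}
    (H : ∀ i₁ i₂ i₃ (h : i₁ + i₂ + i₃ = n),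
      ι₃' K L P i₁ i₂ i₃ n _ rfl h ≫ f = ι₃' K L P i₁ i₂ i₃ n _ rfl h ≫ g) : f = g :=
  GradedObject.Monoidal.tensorObj₃'_ext (X₁ := K.X) (X₂ := L.X) (X₃ := P.X) f g
    (fun i₁ i₂ i₃ h => H i₁ i₂ i₃ h)

lemma units_smul_whiskerRight {X Y : ModuleCat.{u} k} (a : ℤˣ) (f : X ⟶ Y) (Z : ModuleCat.{u} k) :
    (a • f) ▷ Z = a • (f ▷ Z) := by
  rw [Units.smul_def, Units.smul_def]
  exact (tensorRight Z).map_zsmul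

lemma whiskerLeft_units_smul {X Y : ModuleCat.{u} k} (a : ℤˣ) (f : X ⟶ Y) (Z : ModuleCat.{u} k) :
    Z ◁ (a • f) = a • (Z ◁ f) := by
  rw [Units.smul_def, Units.smul_def]
  exact (tensorLeft Z).map_zsmul

lemma hexagon :
    (α_ K L P).hom ≫ (braiding K (L ⊗ P)).hom ≫ (α_ L P K).hom =
      (braiding K L).hom ▷ P ≫ (α_ L K P).hom ≫ L ◁ (braiding K P).hom := by
  ext1 n
  refine hom_ext₃' _ _ _ (fun i₁ i₂ i₃ h => ?_)
  simp only [HomologicalComplex.comp_f]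
  rw [← Category.assoc, ι₃'_associator K L P i₁ i₂ i₃ n _ (i₂ + i₃) rfl h rfl (by omega)]
  have e1 : ι₃ K L P i₁ i₂ i₃ n (i₂ + i₃) rfl (by omega) ≫ (braiding K (L ⊗ P)).hom.f n =
      (i₁ * (i₂ + i₃)).negOnePow • ((β_ (K.X i₁) (L.X i₂ ⊗ P.X i₃)).hom ≫
        ι₃' L P K i₂ i₃ i₁ n (i₂ + i₃) rfl (by omega)) := by
    simp only [ι₃, ι₃', Category.assoc, ι_braiding, Linear.comp_units_smul]
    exact congrArg _ (BraidedCategory.braiding_naturality_right_assoc (K.X i₁)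
      (ιTensorObj L P i₂ i₃ _ rfl) _)
  have e2 : ι₃' K L P i₁ i₂ i₃ n (i₁ + i₂) rfl h ≫ ((braiding K L).hom ▷ P).f n =
      (i₁ * i₂).negOnePow • ((β_ (K.X i₁) (L.X i₂)).hom ▷ P.X i₃ ≫
        ι₃' L K P i₂ i₁ i₃ n (i₁ + i₂) (add_comm _ _) h) := by
    simp only [ι₃', Category.assoc, ι_whiskerRight]
    rw [← comp_whiskerRight_assoc, ι_braiding, units_smul_whiskerRight, Linear.units_smul_comp,
      comp_whiskerRight, Category.assoc]
  have e3 : ι₃ L K P i₂ i₁ i₃ n (i₁ + i₃) rfl (by omega) ≫ (L ◁ (braiding K P).hom).f n =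
      (i₁ * i₃).negOnePow • ((L.X i₂ ◁ (β_ (K.X i₁) (P.X i₃)).hom) ≫
        ι₃ L P K i₂ i₃ i₁ n (i₁ + i₃) (add_comm _ _) (by omega)) := by
    simp only [ι₃, Category.assoc, ι_whiskerLeft]
    rw [← whiskerLeft_comp_assoc, ι_braiding, whiskerLeft_units_smul, Linear.units_smul_comp,
      whiskerLeft_comp, Category.assoc]
  rw [Category.assoc, ← Category.assoc (ι₃ _ _ _ _ _ _ _ _ _ _), e1, ← Category.assoc (ι₃' _ _ _ _ _ _ _ _ _ _), e2]
  simp only [Linear.units_smul_comp, Category.assoc, Linear.comp_units_smul]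
  rw [ι₃'_associator L P K i₂ i₃ i₁ n _ (i₁ + i₃) rfl _ (add_comm _ _) (by omega),
    ← Category.assoc (ι₃' _ _ _ _ _ _ _ _ _ _), ι₃'_associator L K P i₂ i₁ i₃ n _ (i₁ + i₃) _ h rfl (by omega), Category.assoc, e3]
  simp only [Linear.comp_units_smul, smul_smul, ← Int.negOnePow_add, ← mul_add]
  congr 1
  simp only [BraidedCategory.hexagon_forward_assoc]

noncomputable instance : SymmetricCategory (CochainComplex (ModuleCat.{u} k) ℤ) where
  braiding := braiding
  braiding_naturality_right K _ _ f := braiding_naturality_right K f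
  braiding_naturality_left f L := braiding_naturality_left L f
  hexagon_forward := hexagon
  hexagon_reverse K L P := by
    have e : α_ P K L ≪≫ braiding P (K ⊗ L) ≪≫ α_ K L P =
        whiskerRightIso (braiding P K) L ≪≫ α_ K P L ≪≫ whiskerLeftIso K (braiding P L) :=
      Iso.ext (hexagon P K L)
    have e' := congrArg Iso.inv e
    simp only [Iso.trans_inv, whiskerRightIso_inv, whiskerLeftIso_inv, Category.assoc] at e'
    exact e'
  symmetry K L := (braiding K L).hom_inv_id

end KoszulBraiding

/-! ### The derived category of a field, with its symmetric monoidal structure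

Over a field, tensoring preserves quasi-isomorphisms, so the tensor product of complexes descends
to the derived category. -/

section DerivedTensor
variable (k : Type u) [Field k]

lemma exists_quasiInverse {V W : ModuleCat.{u} k} (d : V ⟶ W) : ∃ r : W ⟶ V, d ≫ r ≫ d = d := by
  obtain ⟨s, hs⟩ := (LinearMap.rangeRestrict d.hom).exists_rightInverse_of_surjective
    (LinearMap.range_rangeRestrict _)
  obtain ⟨p, hp⟩ := Submodule.exists_isCompl (LinearMap.range d.hom)
  refine ⟨ModuleCat.ofHom (s ∘ₗ Submodule.projectionOnto _ p hp), ?_⟩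
  ext x
  have h1 : Submodule.projectionOnto (LinearMap.range d.hom) p hp (d.hom x)
      = LinearMap.rangeRestrict d.hom x :=
    Submodule.projectionOnto_apply_left hp (LinearMap.rangeRestrict d.hom x)
  have h2 := LinearMap.congr_fun hs (LinearMap.rangeRestrict d.hom x)
  have h3 := congrArg Subtype.val h2
  simpa [h1] using h3

instance isKProjective_field (K : CochainComplex (ModuleCat.{u} k) ℤ) : K.IsKProjective where
  nonempty_homotopy_zero {L} f hL := by
    choose R hR using fun i j : ℤ => exists_quasiInverse k (L.d j i)
    let h : ∀ i j : ℤ, (ComplexShape.up ℤ).Rel j i → (L.X i ⟶ L.X j) := fun i j _ =>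
      (𝟙 _ - L.d i (i + 1) ≫ R (i + 1) i) ≫ R i j
    have key : Homotopy.nullHomotopicMap' h = 𝟙 L := by
      ext1 i
      rw [Homotopy.nullHomotopicMap'_f (k₂ := i - 1) (k₀ := i + 1) (by simp) (by simp)]
      have h1 : L.d i (i + 1) ≫ h (i + 1) i (by simp) = L.d i (i+1) ≫ R (i+1) i := by
        simp [h]
      have h2 : h i (i - 1) (by simp) ≫ L.d (i - 1) i = 𝟙 _ - L.d i (i + 1) ≫ R (i + 1) i := by
        have ex := (HomologicalComplex.exactAt_iff' L (i - 1) i (i + 1) (by simp) (by simp)).1 (hL i)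
        rw [ShortComplex.moduleCat_exact_iff] at ex
        have hz : (𝟙 _ - L.d i (i + 1) ≫ R (i + 1) i) ≫ L.d i (i + 1) = 0 := by
          simp [hR]
        ext x
        obtain ⟨y, hy⟩ := ex ((𝟙 _ - L.d i (i + 1) ≫ R (i + 1) i).hom x)
          (congrArg (fun g => g.hom x) hz)
        have hy' : (L.d (i - 1) i).hom y = (𝟙 _ - L.d i (i + 1) ≫ R (i + 1) i).hom x := hy
        have hr := congrArg (fun g => g.hom y) (hR i (i - 1))
        simp only [h, ModuleCat.hom_comp, LinearMap.comp_apply]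
        rw [← hy']
        exact hr
      rw [h1, h2]; simp
    have e : Homotopy (𝟙 L) 0 := (Homotopy.ofEq key.symm).trans (Homotopy.nullHomotopy' h)
    exact ⟨(Homotopy.ofEq (by simp)).trans ((e.compLeft f).trans (Homotopy.ofEq (by simp)))⟩

instance : (HomologicalComplex.quasiIso (ModuleCat.{u} k) (ComplexShape.up ℤ)).IsMonoidal where
  whiskerLeft X {Y₁ Y₂} g hg := by
    rw [HomologicalComplex.mem_quasiIso_iff, CochainComplex.IsKProjective.quasiIso_iff] at *
    obtain ⟨e, rfl⟩ := hg
    refine ⟨⟨X ◁ e.hom, X ◁ e.inv, ?_, ?_⟩, rfl⟩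
    · exact (Homotopy.ofEq (by rw [← MonoidalCategory.whiskerLeft_comp]; rfl)).trans
        ((HomologicalComplex.mapBifunctorMapHomotopy₂ (𝟙 X) e.homotopyHomInvId (curriedTensor _)
          (ComplexShape.up ℤ)).trans (Homotopy.ofEq (MonoidalCategory.whiskerLeft_id X Y₁)))
    · exact (Homotopy.ofEq (by rw [← MonoidalCategory.whiskerLeft_comp]; rfl)).trans
        ((HomologicalComplex.mapBifunctorMapHomotopy₂ (𝟙 X) e.homotopyInvHomId (curriedTensor _)
          (ComplexShape.up ℤ)).trans (Homotopy.ofEq (MonoidalCategory.whiskerLeft_id X Y₂)))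
  whiskerRight {X₁ X₂} f hf Y := by
    rw [HomologicalComplex.mem_quasiIso_iff, CochainComplex.IsKProjective.quasiIso_iff] at *
    obtain ⟨e, rfl⟩ := hf
    refine ⟨⟨e.hom ▷ Y, e.inv ▷ Y, ?_, ?_⟩, rfl⟩
    · exact (Homotopy.ofEq (by rw [← MonoidalCategory.comp_whiskerRight]; rfl)).trans
        ((HomologicalComplex.mapBifunctorMapHomotopy₁ e.homotopyHomInvId (𝟙 Y) (curriedTensor _)
          (ComplexShape.up ℤ)).trans (Homotopy.ofEq (MonoidalCategory.id_whiskerRight X₁ Y)))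
    · exact (Homotopy.ofEq (by rw [← MonoidalCategory.comp_whiskerRight]; rfl)).trans
        ((HomologicalComplex.mapBifunctorMapHomotopy₁ e.homotopyInvHomId (𝟙 Y) (curriedTensor _)
          (ComplexShape.up ℤ)).trans (Homotopy.ofEq (MonoidalCategory.id_whiskerRight X₂ Y)))

variable [HasDerivedCategory.{w} (ModuleCat.{u} k)]

/-- The tensor product of the derived category, for which the localization functor `Q` from
complexes is monoidal. -/
noncomputable instance derivedMonoidal : MonoidalCategory (DerivedCategory (ModuleCat.{u} k)) :=
  inferInstanceAs (MonoidalCategory (LocalizedMonoidal (DerivedCategory.Q (C := ModuleCat.{u} k))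
    (HomologicalComplex.quasiIso (ModuleCat.{u} k) (ComplexShape.up ℤ))
    (Iso.refl (DerivedCategory.Q.obj (𝟙_ (CochainComplex (ModuleCat.{u} k) ℤ))))))

instance : MonoidalPreadditive (CochainComplex (ModuleCat.{u} k) ℤ) where
  whiskerLeft_zero {X Y Z} := by
    ext n : 1
    refine HomologicalComplex.mapBifunctor.hom_ext (fun i j h => ?_)
    erw [HomologicalComplex.ι_mapBifunctorMap]
    simp
  zero_whiskerRight {X Y Z} := by
    ext n : 1
    refine HomologicalComplex.mapBifunctor.hom_ext (fun i j h => ?_)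
    erw [HomologicalComplex.ι_mapBifunctorMap]
    simp
  whiskerLeft_add {X Y Z} f g := by
    ext n : 1
    refine HomologicalComplex.mapBifunctor.hom_ext (fun i j h => ?_)
    rw [HomologicalComplex.add_f_apply, Preadditive.comp_add]
    erw [HomologicalComplex.ι_mapBifunctorMap, HomologicalComplex.ι_mapBifunctorMap, HomologicalComplex.ι_mapBifunctorMap]
    simp
  add_whiskerRight {X Y Z} f g := by
    ext n : 1
    refine HomologicalComplex.mapBifunctor.hom_ext (fun i j h => ?_)
    rw [HomologicalComplex.add_f_apply, Preadditive.comp_add]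
    erw [HomologicalComplex.ι_mapBifunctorMap, HomologicalComplex.ι_mapBifunctorMap, HomologicalComplex.ι_mapBifunctorMap]
    simp

instance : (DerivedCategory.Q (C := ModuleCat.{u} k)).Full := by
  have : (DerivedCategory.Qh (C := ModuleCat.{u} k)).Full := ⟨by
    intro X Y f
    obtain ⟨K, rfl⟩ := HomotopyCategory.quotient_obj_surjective X
    exact (CochainComplex.IsKProjective.Qh_map_bijective K Y).2 f⟩
  exact Functor.Full.of_iso (DerivedCategory.quotientCompQhIso (ModuleCat.{u} k))

noncomputable instance : (DerivedCategory.Q (C := ModuleCat.{u} k)).Monoidal :=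
  (inferInstance : (Localization.Monoidal.toMonoidalCategory (DerivedCategory.Q (C := ModuleCat.{u} k))
    (HomologicalComplex.quasiIso (ModuleCat.{u} k) (ComplexShape.up ℤ))
    (Iso.refl (DerivedCategory.Q.obj (𝟙_ (CochainComplex (ModuleCat.{u} k) ℤ))))).Monoidal)

instance : MonoidalPreadditive (DerivedCategory (ModuleCat.{u} k)) := by
  let F := DerivedCategory.Q (C := ModuleCat.{u} k)
  have hl (X : DerivedCategory (ModuleCat.{u} k)) : (tensorLeft X).Additive := by
    have : (F ⋙ tensorLeft (F.obj (F.objPreimage X))).Additive :=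
      Functor.additive_of_iso (F := tensorLeft (F.objPreimage X) ⋙ F)
        (NatIso.ofComponents (fun Y => (Functor.Monoidal.μIso F _ _).symm) (by simp))
    have := Functor.additive_of_full_essSurj_comp F (tensorLeft (F.obj (F.objPreimage X)))
    exact Functor.additive_of_iso (F := tensorLeft (F.obj (F.objPreimage X)))
      ((curriedTensor _).mapIso (F.objObjPreimageIso X))
  have hr (X : DerivedCategory (ModuleCat.{u} k)) : (tensorRight X).Additive := by
    have : (F ⋙ tensorRight (F.obj (F.objPreimage X))).Additive :=
      Functor.additive_of_iso (F := tensorRight (F.objPreimage X) ⋙ F)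
        (NatIso.ofComponents (fun Y => (Functor.Monoidal.μIso F _ _).symm) (by simp))
    have := Functor.additive_of_full_essSurj_comp F (tensorRight (F.obj (F.objPreimage X)))
    exact Functor.additive_of_iso (F := tensorRight (F.obj (F.objPreimage X)))
      ((curriedTensor _).flip.mapIso (F.objObjPreimageIso X))
  exact
  { whiskerLeft_zero := fun {X Y Z} => (tensorLeft X).map_zero Y Z
    zero_whiskerRight := fun {X Y Z} => (tensorRight X).map_zero Y Z
    whiskerLeft_add := fun {X Y Z} f g => (tensorLeft X).map_add
    add_whiskerRight := fun {X Y Z} f g => (tensorRight X).map_add }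

noncomputable instance derivedSymmetric :
    SymmetricCategory (DerivedCategory (ModuleCat.{u} k)) :=
  inferInstanceAs (SymmetricCategory (LocalizedMonoidal (DerivedCategory.Q (C := ModuleCat.{u} k))
    (HomologicalComplex.quasiIso (ModuleCat.{u} k) (ComplexShape.up ℤ))
    (Iso.refl (DerivedCategory.Q.obj (𝟙_ (CochainComplex (ModuleCat.{u} k) ℤ))))))

end DerivedTensor

/-! ### Direct sums of triangulated categories: shifts and distinguished triangles levelwise -/

namespace LevelwiseTriangulated
open Pretriangulated ZeroObject
universe v₁ u₁ w₁
variable (J : Type w₁) (C : Type u₁) [Category.{v₁} C]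

lemma eqToHom_apply {X Y : GradedObject J C} (h : X = Y) (j : J) :
    (eqToHom h : X ⟶ Y) j = eqToHom (congrFun h j) := by
  subst h; rfl

section
variable [HasShift C ℤ]

/-- The levelwise shift. -/
noncomputable def shiftF (n : ℤ) : GradedObject J C ⥤ GradedObject J C where
  obj X := fun j => (X j)⟦n⟧
  map f := fun j => (f j)⟦n⟧'
  map_id X := by funext j; exact (shiftFunctor C n).map_id (X j)
  map_comp f g := by funext j; exact (shiftFunctor C n).map_comp (f j) (g j)

noncomputable instance levelwiseShift : HasShift (GradedObject J C) ℤ :=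
  hasShiftMk _ _
    { F := shiftF J C
      zero := NatIso.ofComponents
        (fun X => GradedObject.isoMk _ _ (fun j => (shiftFunctorZero C ℤ).app (X j)))
        (fun f => by funext j; exact (shiftFunctorZero C ℤ).hom.naturality (f j))
      add := fun n m => NatIso.ofComponents
        (fun X => GradedObject.isoMk _ _ (fun j => (shiftFunctorAdd C n m).app (X j)))
        (fun f => by funext j; exact (shiftFunctorAdd C n m).hom.naturality (f j))
      assoc_hom_app := fun n m p X => by
        funext j
        refine (shiftFunctorAdd_assoc_hom_app n m p (X j)).trans ?_
        refine Eq.trans ?_ (congrArg (· ≫ _) (eqToHom_apply J C (X := (shiftF J C (n + m + p)).obj X)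
          (Y := (shiftF J C (n + (m + p))).obj X) (by rw [add_assoc]) j).symm)
        simp only [shiftFunctorAdd', Iso.trans_hom, NatTrans.comp_app, Category.assoc,
          eqToIso.hom, eqToHom_app]
        rfl
      zero_add_hom_app := fun n X => by
        funext j
        exact (shiftFunctorAdd_zero_add_hom_app n (X j)).trans
          (congrArg (· ≫ _) (eqToHom_apply J C (X := (shiftF J C (0 + n)).obj X)
            (Y := (shiftF J C n).obj X) (by rw [zero_add]) j).symm)
      add_zero_hom_app := fun n X => by
        funext j
        exact (shiftFunctorAdd_add_zero_hom_app n (X j)).trans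
          (congrArg (· ≫ _) (eqToHom_apply J C (X := (shiftF J C (n + 0)).obj X)
            (Y := (shiftF J C n).obj X) (by rw [add_zero]) j).symm) }

end

instance levelwisePreadditive [Preadditive C] : Preadditive (GradedObject J C) where
  homGroup X Y := inferInstanceAs (AddCommGroup (∀ j, X j ⟶ Y j))
  add_comp X Y Z f f' g := by funext j; exact Preadditive.add_comp _ _ _ (f j) (f' j) (g j)
  comp_add X Y Z f g g' := by funext j; exact Preadditive.comp_add _ _ _ (f j) (g j) (g' j)

variable [HasShift C ℤ] [Preadditive C] [HasZeroObject C] [∀ n : ℤ, (shiftFunctor C n).Additive]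

instance (n : ℤ) : (shiftFunctor (GradedObject J C) n).Additive where
  map_add {X Y f g} := by
    funext j
    exact (shiftFunctor C n).map_add (f := f j) (g := g j)

variable {J C} in
/-- The component of index `j` of a triangle. -/
noncomputable def component (T : Triangle (GradedObject J C)) (j : J) : Triangle C :=
  Triangle.mk (T.mor₁ j) (T.mor₂ j) (T.mor₃ j)

variable [Pretriangulated C]

/-- A triangle is distinguished if and only if all its components are. -/
noncomputable instance levelwisePretriangulated : Pretriangulated (GradedObject J C) where
  distinguishedTriangles := {T | ∀ j, component T j ∈ distTriang C}
  isomorphic_distinguished T₁ h₁ T₂ e j :=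
    isomorphic_distinguished _ (h₁ j) _
      (Triangle.isoMk _ _
        ((GradedObject.eval j).mapIso (Triangle.π₁.mapIso e))
        ((GradedObject.eval j).mapIso (Triangle.π₂.mapIso e))
        ((GradedObject.eval j).mapIso (Triangle.π₃.mapIso e))
        (congrFun e.hom.comm₁ j) (congrFun e.hom.comm₂ j) (congrFun e.hom.comm₃ j))
  contractible_distinguished X j := by
    have hz : IsZero ((0 : GradedObject J C) j) := (IsZero.iff_id_eq_zero _).2
      (congrFun ((isZero_zero (GradedObject J C)).eq_of_src (𝟙 _) 0) j)
    exact isomorphic_distinguished _ (contractible_distinguished (X j)) _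
      (Triangle.isoMk _ _ (Iso.refl _) (Iso.refl _) (hz.iso (isZero_zero C))
        ((Category.comp_id _).trans (Category.id_comp _).symm)
        ((isZero_zero C).eq_of_tgt _ _) (hz.eq_of_src _ _))
  distinguished_cocone_triangle {X Y} f := by
    choose Z g h hT using fun j => distinguished_cocone_triangle (f j)
    exact ⟨Z, g, h, hT⟩
  rotate_distinguished_triangle T := forall_congr' fun j => by
    rw [rotate_distinguished_triangle]
    rfl
  complete_distinguished_triangle_morphism T₁ T₂ h₁ h₂ a b hab := by
    choose c hc using fun j => complete_distinguished_triangle_morphism _ _ (h₁ j) (h₂ j)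
      (a j) (b j) (congrFun hab j)
    exact ⟨c, funext fun j => (hc j).1, funext fun j => (hc j).2⟩

instance levelwiseIsTriangulated [IsTriangulated C] : IsTriangulated (GradedObject J C) where
  octahedron_axiom {X₁ X₂ X₃ Z₁₂ Z₂₃ Z₁₃ u₁₂ u₂₃ u₁₃} comm {v₁₂ w₁₂} h₁₂ {v₂₃ w₂₃} h₂₃
      {v₁₃ w₁₃} h₁₃ := by
    have o (j : J) := Triangulated.someOctahedron (congrFun comm j) (h₁₂ j) (h₂₃ j) (h₁₃ j)
    exact ⟨{
      m₁ := fun j => (o j).m₁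
      m₃ := fun j => (o j).m₃
      comm₁ := funext fun j => (o j).comm₁
      comm₂ := funext fun j => (o j).comm₂
      comm₃ := funext fun j => (o j).comm₃
      comm₄ := funext fun j => (o j).comm₄
      mem := fun j => (o j).mem }⟩

end LevelwiseTriangulated

/-! ### The monoid with two elements and the category graded by it -/

/-- The underlying set of the monoid `{1, m}` with identity `1` and `m * m = m`. -/
inductive TwoMonoid : Type
  | one
  | m

namespace TwoMonoid

instance : DecidableEq TwoMonoid
  | one, one => isTrue rfl
  | m, m => isTrue rfl
  | one, m => isFalse (fun h => nomatch h)
  | m, one => isFalse (fun h => nomatch h)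

instance : Finite TwoMonoid := Finite.of_surjective (fun b : Bool => cond b one m)
  (fun x => by cases x; exacts [⟨true, rfl⟩, ⟨false, rfl⟩])
/-- The multiplication. -/
def mul : TwoMonoid → TwoMonoid → TwoMonoid
  | one, x => x
  | m, _ => m
instance : CommMonoid TwoMonoid where
  mul := mul
  one := one
  one_mul := by rintro (_ | _) <;> rfl
  mul_one := by rintro (_ | _) <;> rfl
  mul_assoc := by rintro (_ | _) (_ | _) (_ | _) <;> rfl
  mul_comm := by rintro (_ | _) (_ | _) <;> rfl
end TwoMonoid

section Category
variable (k : Type u) [Field k] [HasDerivedCategory.{w} (ModuleCat.{u} k)]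

/-- The direct sum of two copies of the derived category of `k`, indexed by the monoid `{1, m}`:
an object is a pair `(X_1, X_m)`. -/
abbrev TM := GradedObject (Additive TwoMonoid) (DerivedCategory (ModuleCat.{u} k))

instance (X Y Z W : TM k) : GradedObject.HasTensor₄ObjExt X Y Z W := fun i j => by
  have : Finite { i : Additive TwoMonoid × Additive TwoMonoid × Additive TwoMonoid |
    i.1 + i.2.1 + i.2.2 = j } := inferInstance
  infer_instance

/-- The convolution product: `(X ⊗ Y)_c` is the coproduct of the `X_a ⊗ Y_b` with `a * b = c`. -/
noncomputable instance : MonoidalCategory (TM k) := GradedObject.monoidalCategory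

noncomputable instance : SymmetricCategory (TM k) := GradedObject.symmetricCategory

end Category

/-! ### Tensor triangular geometry

Throughout, `T` is a triangulated category with a symmetric monoidal structure. "Small" means
indexed by a type in the universe `u`. -/

section General

variable {T : Type*} [Category T] [Preadditive T] [HasZeroObject T]
  [HasShift T ℤ] [∀ n : ℤ, (shiftFunctor T n).Additive] [Pretriangulated T]

/-- The Bousfield class of `X`: the class of objects `Y` with `X ⊗ Y = 0`. -/
def bousfieldClass [MonoidalCategory T] (X : T) : ObjectProperty T :=
  fun Y => IsZero (X ⊗ Y)

/-- The Bousfield lattice: the set of Bousfield classes, ordered by reverse inclusion. -/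
abbrev BousfieldLattice (T : Type*) [Category T] [MonoidalCategory T] :=
  {P : (ObjectProperty T)ᵒᵈ // ∃ X : T, bousfieldClass X = OrderDual.ofDual P}

/-- A localizing subcategory: a (strictly full) triangulated subcategory which is closed under
small coproducts. -/
structure IsLocalizing (P : ObjectProperty T) : Prop where
  isTriangulated : P.IsTriangulated
  isClosedUnderIsomorphisms : P.IsClosedUnderIsomorphisms
  coproducts : ∀ I : Type u, P.IsClosedUnderColimitsOfShape (Discrete I)

/-- `loc X` is the smallest localizing subcategory containing `X`. -/
def loc (X : T) : ObjectProperty T :=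
  fun Y => ∀ P : ObjectProperty T, IsLocalizing.{u} P → P X → P Y

/-- Closure under tensoring with arbitrary objects (on either side). -/
def IsTensorIdeal [MonoidalCategory T] (P : ObjectProperty T) : Prop :=
  ∀ X Y : T, P Y → P (X ⊗ Y) ∧ P (Y ⊗ X)

open Classical in
/-- The canonical map `⨁ i, Hom(X, Y i) → Hom(X, ∐ Y)`. -/
noncomputable def coproductComparison {I : Type u} (X : T) {Y : I → T} (c : Cofan Y) :
    (DirectSum I fun i => (X ⟶ Y i)) →+ (X ⟶ c.pt) :=
  DirectSum.toAddMonoid (fun i => Preadditive.rightComp X (c.inj i))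

/-- Compactness: `Hom(X, -)` commutes with small coproducts. -/
def IsCompactObject (X : T) : Prop :=
  ∀ (I : Type u) (Y : I → T) (c : Cofan Y), IsColimit c →
    Function.Bijective (coproductComparison X c)

variable (T) in
/-- `T` has small coproducts and a small set of compact objects `G i` such that an object `X` with
`Hom(G i, X⟦n⟧) = 0` for all `i` and `n` is zero. -/
structure IsCompactlyGeneratedTriangulated : Prop where
  hasCoproducts : ∀ I : Type u, HasCoproductsOfShape I T
  exists_generators : ∃ (I : Type u) (G : I → T), (∀ i, IsCompactObject.{u} (G i)) ∧
    ∀ X : T, (∀ (i : I) (n : ℤ) (f : G i ⟶ X⟦n⟧), f = 0) → IsZero X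

/-- `X` is rigid (strongly dualizable): it has a dual in the monoidal category `T`. -/
def IsDualizable [MonoidalCategory T] (X : T) : Prop :=
  ∃ Y : T, Nonempty (ExactPairing X Y)

variable (T) in
/-- `T` is rigidly compactly generated: it is compactly generated, and the compact objects form a
rigid tensor subcategory (containing the unit, closed under `⊗`, every object having a dual). -/
structure IsRigidlyCompactlyGenerated [MonoidalCategory T] : Prop where
  isCompactlyGenerated : IsCompactlyGeneratedTriangulated.{u} T
  unit : IsCompactObject.{u} (𝟙_ T)
  tensor : ∀ X Y : T, IsCompactObject.{u} X → IsCompactObject.{u} Y → IsCompactObject.{u} (X ⊗ Y)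
  rigid : ∀ X : T, IsCompactObject.{u} X → ∃ Y : T, IsCompactObject.{u} Y ∧ Nonempty (ExactPairing X Y)

/-- A Bousfield localization functor away from `S` (that is, with kernel `S`): for each object `X`
there is a distinguished triangle `F ⟶ X ⟶ L X ⟶ F⟦1⟧` whose second morphism is the component at
`X` of the natural transformation `η`, with `F` in `S` and `L X` right orthogonal to `S`. -/
structure LocalizationAway (S : ObjectProperty T) where
  /-- the localization functor -/
  L : T ⥤ T
  /-- the unit of the localization -/
  η : 𝟭 T ⟶ L
  isLocal : ∀ X Y : T, S Y → ∀ f : Y ⟶ L.obj X, f = 0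
  exists_triangle : ∀ X : T, ∃ (F : T) (_ : S F) (i : F ⟶ X) (δ : L.obj X ⟶ F⟦(1 : ℤ)⟧),
    Pretriangulated.Triangle.mk i (η.app X) δ ∈ Pretriangulated.distinguishedTriangles (C := T)

/-- A localization is smashing if its localization functor preserves small coproducts. -/
def LocalizationAway.IsSmashing {S : ObjectProperty T} (ℒ : LocalizationAway S) : Prop :=
  ∀ I : Type u, PreservesColimitsOfShape (Discrete I) ℒ.L

end General

/-- The object `k_j` of `TM k`, for `j = 1, m`: the one-dimensional vector space `k`, as a complex
in degree `0`, placed in the component of index `j`. -/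
noncomputable def kObj (k : Type u) [Field k] [HasDerivedCategory.{w} (ModuleCat.{u} k)]
    (j : TwoMonoid) : TM k :=
  (GradedObject.single (Additive.ofMul j)).obj
    ((DerivedCategory.singleFunctor (ModuleCat.{u} k) 0).obj (ModuleCat.of k k))

/-! Everything rests on two facts about `D(k)`. Over a field, taking homology identifies `D(k)` with
graded vector spaces (`gradedToDerived` is an equivalence), so every object is a coproduct of shifts
of `k`, and `k` is a compact generator. A tensor product of two nonzero objects is also nonzero
(`derived_isZero_tensor_iff`).

Each product `X_a ⊗ Y_b` occurs as a summand of some component of `X ⊗ Y`, so `TM k` has no zero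
divisors either (`tm_isZero_tensor_iff`). Hence `A(X)` is everything when `X = 0` and consists of
the zero objects otherwise: there are only two Bousfield classes. On the other hand `loc(k_m)` is
the class of all `X` with `X_1 = 0` (`loc_kObj_m_eq`), which is neither of them.

The object `k_m` is compact because `k` is, but it has no dual: a coevaluation `𝟙 ⟶ k_m ⊗ Y` starts
in component `1` and ends in component `m`, so it is zero.

A localization away from `loc(k_m)` must keep the component `1` and kill the component `m`, so it
preserves coproducts. If it were `E ⊗ -`, then `E ⊗ k_m = 0` would force `E = 0`, whereas `k_1` is
not killed. -/

/-! ### Coproducts of graded objects -/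

namespace CategoryTheory.GradedObject

variable {J C : Type*} [Category C] {I : Type*}

/-- The component of index `j` of a cofan of graded objects. -/
def cofanEval {Y : I → GradedObject J C} (c : Cofan Y) (j : J) : Cofan (fun i => Y i j) :=
  Cofan.mk (c.pt j) (fun i => c.inj i j)

/-- A cofan of graded objects is a coproduct if its components are. -/
def isColimitOfCofanEval {Y : I → GradedObject J C} (c : Cofan Y)
    (hc : ∀ j, IsColimit (cofanEval c j)) : IsColimit c :=
  Cofan.IsColimit.mk c
    (fun s j => Cofan.IsColimit.desc (hc j) (fun i => s.inj i j))
    (fun _ i => funext fun j => Cofan.IsColimit.fac (hc j) _ i)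
    (fun s _ hm => funext fun j => Cofan.IsColimit.hom_ext (hc j) _ _ fun i =>
      (congrFun (hm i) j).trans
        (Cofan.IsColimit.fac (hc j) (fun i => s.inj i j) i).symm)

/-- The cofan of graded objects whose components are coproducts. -/
noncomputable def sigmaCofan [HasCoproductsOfShape I C] (Y : I → GradedObject J C) : Cofan Y :=
  Cofan.mk (fun j => ∐ fun i => Y i j) (fun i j => Sigma.ι (fun i => Y i j) i)

/-- The componentwise coproduct is a coproduct. -/
noncomputable def isColimitSigmaCofan [HasCoproductsOfShape I C] (Y : I → GradedObject J C) :
    IsColimit (sigmaCofan Y) :=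
  isColimitOfCofanEval _ fun j => coproductIsCoproduct fun i => Y i j

instance hasCoproductsOfShape [HasCoproductsOfShape I C] :
    HasCoproductsOfShape I (GradedObject J C) where
  has_colimit F :=
    have : HasColimit (Discrete.functor (F.obj ∘ Discrete.mk)) :=
      ⟨⟨_, isColimitSigmaCofan (F.obj ∘ Discrete.mk)⟩⟩
    hasColimit_of_iso Discrete.natIsoFunctor

/-- A cocone of graded objects is a colimit if its components are. -/
def isColimitOfEval {A : Type*} [Category A] {K : A ⥤ GradedObject J C} (c : Cocone K)
    (hc : ∀ j, IsColimit ((eval j).mapCocone c)) : IsColimit c where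
  desc s := fun j => (hc j).desc ((eval j).mapCocone s)
  fac s a := funext fun j => (hc j).fac ((eval j).mapCocone s) a
  uniq s _ hm := funext fun j => (hc j).uniq ((eval j).mapCocone s) _ fun a => congrFun (hm a) j

/-! ### Objects concentrated in one degree, and the adjunction with evaluation. -/

section Single

variable [Preadditive C] [HasInitial C] [DecidableEq J]

lemma isZero_single_apply (j : J) (V : C) {i : J} (h : i ≠ j) :
    IsZero ((single j).obj V i) :=
  (isInitialSingleObjApply j V i h).isZero

lemma single_hom_ext {j : J} {V : C} {X : GradedObject J C} {f g : (single j).obj V ⟶ X}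
    (h : f j = g j) : f = g := by
  funext i
  by_cases hi : i = j
  · subst hi; exact h
  · exact (isZero_single_apply j V hi).eq_of_src _ _

/-- The map to `(single j).obj V` determined by a map to `V`. -/
noncomputable def singleLift {j : J} {V : C} {X : GradedObject J C} (f : X j ⟶ V) :
    X ⟶ (single j).obj V := fun i =>
  if h : i = j then eqToHom (by rw [h]) ≫ f ≫ (singleObjApplyIsoOfEq j V i h).inv else 0

lemma singleLift_apply {j : J} {V : C} {X : GradedObject J C} (f : X j ⟶ V) :
    singleLift f j = f ≫ (singleObjApplyIso j V).inv := by
  simp [singleLift]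

lemma hom_single_ext {j : J} {V : C} {X : GradedObject J C} {f g : X ⟶ (single j).obj V}
    (h : f j = g j) : f = g := by
  funext i
  by_cases hi : i = j
  · subst hi; exact h
  · exact (isZero_single_apply j V hi).eq_of_tgt _ _

/-- The universal property of `(single j).obj V` as a target. -/
noncomputable def homSingleEquiv {j : J} (X : GradedObject J C) (V : C) :
    (X j ⟶ V) ≃ (X ⟶ (single j).obj V) where
  toFun f := singleLift f
  invFun g := g j ≫ (singleObjApplyIso j V).hom
  left_inv f := by
    change singleLift f j ≫ _ = f
    rw [singleLift_apply, Category.assoc, Iso.inv_hom_id, Category.comp_id]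
  right_inv g := hom_single_ext (by
    change singleLift (g j ≫ _) j = g j
    rw [singleLift_apply, Category.assoc, Iso.hom_inv_id, Category.comp_id])

lemma singleLift_comp {j : J} {V W : C} {X : GradedObject J C} (f : X j ⟶ V) (g : V ⟶ W) :
    singleLift (f ≫ g) = singleLift f ≫ (single j).map g := hom_single_ext (by
  refine (singleLift_apply _).trans (Eq.trans ?_
    (congrArg (· ≫ (single j).map g j) (singleLift_apply f)).symm)
  rw [Category.assoc, Category.assoc, singleObjApplyIso_inv_single_map])

/-- Evaluation in degree `j` is left adjoint to `single j` (as well as right adjoint). -/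
noncomputable def evalAdjunction (j : J) : eval j ⊣ single (C := C) j :=
  Adjunction.mkOfHomEquiv
    { homEquiv := fun X V => homSingleEquiv X V
      homEquiv_naturality_left_symm := fun _ _ => Category.assoc _ _ _
      homEquiv_naturality_right := fun {X _ _} f g => singleLift_comp (X := X) (j := j) f g }

end Single

/-- Evaluation is a left adjoint by `evalAdjunction`, so it preserves every colimit that happens to
exist; `C` itself need not have colimits of that shape. -/
instance preservesColimitsOfShape_eval [Preadditive C] [HasInitial C] {A : Type*} [Category A]
    (j : J) : PreservesColimitsOfShape A (eval (C := C) j) := by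
  classical
  exact (evalAdjunction j).leftAdjoint_preservesColimits.preservesColimitsOfShape

/-- The components of a coproduct of graded objects are coproducts. -/
noncomputable def isColimitCofanEval [Preadditive C] [HasInitial C] {Y : I → GradedObject J C}
    (c : Cofan Y) (hc : IsColimit c) (j : J) : IsColimit (cofanEval c j) :=
  isColimitCofanMkObjOfIsColimit (eval j) Y c.inj
    (hc.ofIsoColimit (Cofan.ext (Iso.refl _) fun _ => Category.comp_id _))

end CategoryTheory.GradedObject

/-! ### The derived category of a field and graded vector spaces -/

section
variable (k : Type u) [Field k]

/-- The complex with zero differentials on a graded vector space. -/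
@[simps]
def zeroDifferential : GradedObject ℤ (ModuleCat.{u} k) ⥤ CochainComplex (ModuleCat.{u} k) ℤ where
  obj G := { X := G, d := fun _ _ => 0 }
  map f := { f := f }

instance : (zeroDifferential k).Additive where

instance : (zeroDifferential k).Full where
  map_surjective f := ⟨f.f, rfl⟩

instance (V : ModuleCat.{u} k) : Projective V := ModuleCat.projective_of_free
  (Module.Free.chooseBasis k V)

variable {k} in
-- With zero differential, `L.X n` is identified both with the cycles and with the homology of `L`.
-- Under this identification `φ` induces on homology the map `s n ≫ K.homologyπ n`.
lemma quasiIso_of_d_eq_zero {L K : CochainComplex (ModuleCat.{u} k) ℤ}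
    (hL : ∀ i j, L.d i j = 0) (φ : L ⟶ K) (s : ∀ n, L.X n ⟶ K.cycles n)
    (hs : ∀ n, s n ≫ K.iCycles n = φ.f n) (hs' : ∀ n, IsIso (s n ≫ K.homologyπ n)) :
    QuasiIso φ where
  quasiIsoAt n := by
    rw [quasiIsoAt_iff_isIso_homologyMap]
    have : IsIso (L.iCycles n) := L.isIso_iCycles n _ rfl (hL _ _)
    have : IsIso (L.homologyπ n) := L.isIso_homologyπ _ n rfl (hL _ _)
    have h1 : HomologicalComplex.cyclesMap φ n = L.iCycles n ≫ s n := by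
      rw [← cancel_mono (K.iCycles n), HomologicalComplex.cyclesMap_i, Category.assoc, hs]
    have h2 : L.homologyπ n ≫ HomologicalComplex.homologyMap φ n =
        L.iCycles n ≫ (s n ≫ K.homologyπ n) := by
      rw [HomologicalComplex.homologyπ_naturality, h1, Category.assoc]
    have := hs' n
    exact IsIso.of_isIso_fac_left h2

/-- Formality over a field: vector spaces are projective, so the projection from cycles to homology
splits, and the splittings assemble into a quasi-isomorphism from the homology of `K`. -/
lemma exists_quasiIso_zeroDifferential (K : CochainComplex (ModuleCat.{u} k) ℤ) :
    ∃ (G : GradedObject ℤ (ModuleCat.{u} k)) (φ : (zeroDifferential k).obj G ⟶ K), QuasiIso φ := by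
  let s (n : ℤ) : K.homology n ⟶ K.cycles n := Projective.factorThru (𝟙 _) (K.homologyπ n)
  have hs (n : ℤ) : s n ≫ K.homologyπ n = 𝟙 _ := Projective.factorThru_comp _ _
  have hd (i j : ℤ) : (s i ≫ K.iCycles i) ≫ K.d i j = 0 := by simp
  refine ⟨fun n => K.homology n, { f := fun n => s n ≫ K.iCycles n
                                   comm' := fun i j _ => (hd i j).trans zero_comp.symm },
    quasiIso_of_d_eq_zero (fun _ _ => rfl) _ s (fun _ => rfl) fun n => ?_⟩
  exact hs n ▸ inferInstanceAs (IsIso (𝟙 (K.homology n)))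

/-! ### Lines and homogeneous bases of graded vector spaces. -/

/-- The one-dimensional vector space `k` in degree `n`. -/
noncomputable def gradedLine (n : ℤ) : GradedObject ℤ (ModuleCat.{u} k) :=
  ((HomologicalComplex.single (ModuleCat.{u} k) (ComplexShape.up ℤ) n).obj (ModuleCat.of k k)).X

/-- The complex on `gradedLine k n` is the single complex. -/
noncomputable def zeroDifferentialGradedLineIso (n : ℤ) :
    (zeroDifferential k).obj (gradedLine k n) ≅
    (HomologicalComplex.single (ModuleCat.{u} k) (ComplexShape.up ℤ) n).obj (ModuleCat.of k k) :=
  HomologicalComplex.Hom.isoOfComponents (fun _ => Iso.refl _)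
    (fun _ _ _ => comp_zero.trans zero_comp.symm)

/-- The canonical generator of `gradedLine k n`. -/
noncomputable def gradedLineGen (n : ℤ) : gradedLine k n n :=
  (HomologicalComplex.singleObjXSelf (ComplexShape.up ℤ) n (ModuleCat.of k k)).inv.hom (1 : k)

lemma gradedLine_hom_ext {n : ℤ} {G : GradedObject ℤ (ModuleCat.{u} k)} {f g : gradedLine k n ⟶ G}
    (h : (f n).hom (gradedLineGen k n) = (g n).hom (gradedLineGen k n)) : f = g := by
  funext i
  by_cases hi : i = n
  · subst hi
    refine (cancel_epi
      (HomologicalComplex.singleObjXSelf (ComplexShape.up ℤ) i (ModuleCat.of k k)).inv).1 ?_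
    ext
    exact h
  · exact (HomologicalComplex.isZero_single_obj_X (ComplexShape.up ℤ) n (ModuleCat.of k k) i
      hi).eq_of_src _ _

lemma exists_gradedLine_hom {n : ℤ} {G : GradedObject ℤ (ModuleCat.{u} k)} (x : G n) :
    ∃ f : gradedLine k n ⟶ G, (f n).hom (gradedLineGen k n) = x := by
  let φ : ModuleCat.of k k ⟶ G n := ModuleCat.ofHom (LinearMap.toSpanSingleton k (G n) x)
  let ψ := HomologicalComplex.mkHomFromSingle (K := (zeroDifferential k).obj G)
    (c := ComplexShape.up ℤ) φ (fun _ _ => comp_zero)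
  have h : (HomologicalComplex.singleObjXSelf (ComplexShape.up ℤ) n (ModuleCat.of k k)).inv ≫
      ψ.f n = φ :=
    (congrArg (_ ≫ ·) (HomologicalComplex.mkHomFromSingle_f _ _)).trans (Iso.inv_hom_id_assoc _ _)
  exact ⟨ψ.f, (congrArg (fun f => f.hom (1 : k)) h).trans
    (LinearMap.toSpanSingleton_apply_one k (G n) x)⟩

/-- The map from the line in degree `n` determined by an element of degree `n`. -/
noncomputable def gradedLineHom {n : ℤ} {G : GradedObject ℤ (ModuleCat.{u} k)} (x : G n) :
    gradedLine k n ⟶ G :=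
  (exists_gradedLine_hom k x).choose

lemma gradedLineHom_gen {n : ℤ} {G : GradedObject ℤ (ModuleCat.{u} k)} (x : G n) :
    (gradedLineHom k x n).hom (gradedLineGen k n) = x :=
  (exists_gradedLine_hom k x).choose_spec

/-- The cofan of lines spanned by bases of the components of a graded vector space. -/
noncomputable def basisCofan (G : GradedObject ℤ (ModuleCat.{u} k)) :
    Cofan (fun i : Σ n : ℤ, Module.Free.ChooseBasisIndex k (G n) => gradedLine k i.1) :=
  Cofan.mk G (fun i => gradedLineHom k (Module.Free.chooseBasis k (G i.1) i.2))

/-- The map out of a graded vector space given by the images of a homogeneous basis. -/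
noncomputable def basisDesc {G H : GradedObject ℤ (ModuleCat.{u} k)}
    (f : ∀ n, Module.Free.ChooseBasisIndex k (G n) → H n) : G ⟶ H :=
  fun n => ModuleCat.ofHom ((Module.Free.chooseBasis k (G n)).constr k (f n))

lemma basisDesc_basis {G H : GradedObject ℤ (ModuleCat.{u} k)}
    (f : ∀ n, Module.Free.ChooseBasisIndex k (G n) → H n) (n : ℤ)
    (b : Module.Free.ChooseBasisIndex k (G n)) :
    (basisDesc k f n).hom (Module.Free.chooseBasis k (G n) b) = f n b :=
  Module.Basis.constr_basis _ k _ b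

lemma gradedLineHom_comp {n : ℤ} {G H : GradedObject ℤ (ModuleCat.{u} k)} (x : G n) (f : G ⟶ H) :
    ((gradedLineHom k x ≫ f) n).hom (gradedLineGen k n) = (f n).hom x :=
  congrArg (f n).hom (gradedLineHom_gen k x)

/-- A graded vector space is the coproduct of the lines spanned by a homogeneous basis. -/
noncomputable def isColimitBasisCofan (G : GradedObject ℤ (ModuleCat.{u} k)) :
    IsColimit (basisCofan k G) :=
  Cofan.IsColimit.mk _
    (fun s => basisDesc k fun n b => (Cofan.inj s ⟨n, b⟩ n).hom (gradedLineGen k n))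
    (fun _ _ => gradedLine_hom_ext k ((gradedLineHom_comp k _ _).trans (basisDesc_basis k _ _ _)))
    (fun _ m hm => funext fun n => ModuleCat.hom_ext <|
      (Module.Free.chooseBasis k (G n)).ext fun b =>
        ((gradedLineHom_comp k _ m).symm.trans
          (congrArg (fun f => (f n).hom (gradedLineGen k n)) (hm ⟨n, b⟩))).trans
          (basisDesc_basis k _ n b).symm)

/-! ### The equivalence between graded vector spaces and the derived category. -/

variable [HasDerivedCategory.{w} (ModuleCat.{u} k)]

/-- A graded vector space as an object of the derived category. -/
noncomputable def gradedToDerived :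
    GradedObject ℤ (ModuleCat.{u} k) ⥤ DerivedCategory (ModuleCat.{u} k) :=
  zeroDifferential k ⋙ DerivedCategory.Q

instance : (gradedToDerived k).Additive :=
  inferInstanceAs (zeroDifferential k ⋙ DerivedCategory.Q).Additive

instance : (gradedToDerived k).Full :=
  inferInstanceAs (zeroDifferential k ⋙ DerivedCategory.Q).Full

instance : (gradedToDerived k).EssSurj where
  mem_essImage X := by
    obtain ⟨G, φ, hφ⟩ := exists_quasiIso_zeroDifferential k (DerivedCategory.Q.objPreimage X)
    have := (DerivedCategory.isIso_Q_map_iff_quasiIso _ φ).2 hφ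
    exact ⟨G, ⟨@asIso _ _ _ _ (DerivedCategory.Q.map φ) this ≪≫
      DerivedCategory.Q.objObjPreimageIso X⟩⟩

/-- All complexes over `k` are K-projective, so maps that agree in the derived category are
homotopic; between complexes with zero differential, homotopic maps are equal. -/
instance : (gradedToDerived k).Faithful where
  map_injective {G H f g} h := by
    have h1 : (HomotopyCategory.quotient _ _ ⋙ DerivedCategory.Qh).map
        ((zeroDifferential k).map f) = (HomotopyCategory.quotient _ _ ⋙ DerivedCategory.Qh).map
        ((zeroDifferential k).map g) := by
      rw [← cancel_mono ((DerivedCategory.quotientCompQhIso (ModuleCat.{u} k)).hom.app _),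
        NatTrans.naturality, NatTrans.naturality]
      exact congrArg _ h
    have e := HomotopyCategory.homotopyOfEq _ _
      ((CochainComplex.IsKProjective.Qh_map_bijective _ _).1 h1)
    funext n
    refine (e.comm n).trans ?_
    rw [dNext_eq e.hom (show (ComplexShape.up ℤ).Rel n (n + 1) by simp),
      prevD_eq e.hom (show (ComplexShape.up ℤ).Rel (n - 1) n by simp)]
    -- The two zero maps are the differentials of the source and of the target, with `a` and `b` the
    -- components of the homotopy.
    have h2 (a : G (n + 1) ⟶ H n) (b : G n ⟶ H (n - 1)) :
        (0 : G n ⟶ G (n + 1)) ≫ a + b ≫ (0 : H (n - 1) ⟶ H n) + g n = g n := by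
      rw [zero_comp, comp_zero, zero_add, zero_add]
    exact h2 _ _

instance : (gradedToDerived k).IsEquivalence where

instance derivedHasCoproductsOfShape (I : Type u) :
    HasCoproductsOfShape I (DerivedCategory (ModuleCat.{u} k)) :=
  Adjunction.hasColimitsOfShape_of_equivalence (gradedToDerived k).inv

/-- The functor `gradedToDerived` sends the line in degree `n` to `k` in degree `n`. -/
noncomputable def gradedToDerivedGradedLineIso (n : ℤ) :
    (gradedToDerived k).obj (gradedLine k n) ≅
      (DerivedCategory.singleFunctor (ModuleCat.{u} k) n).obj (ModuleCat.of k k) :=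
  DerivedCategory.Q.mapIso (zeroDifferentialGradedLineIso k n)

end

/-! ### Compact objects -/

section Compact

variable {T : Type*} [Category T] [Preadditive T]

open Classical in
lemma coproductComparison_of (X : T) {I : Type u} {Y : I → T} (c : Cofan Y) (i : I) (f : X ⟶ Y i) :
    coproductComparison X c (DirectSum.of (fun i => X ⟶ Y i) i f) = f ≫ c.inj i :=
  DirectSum.toAddMonoid_of _ _ _

/-- Only surjectivity of the comparison map has to be tested: injectivity is automatic, since zero
morphisms provide projections from a coproduct to its summands. -/
lemma isCompactObject_of_exists_sum [HasZeroObject T] {X : T}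
    (H : ∀ (I : Type u) (Y : I → T) (c : Cofan Y), IsColimit c → ∀ f : X ⟶ c.pt,
      ∃ (s : Finset I) (g : ∀ i, X ⟶ Y i), f = ∑ i ∈ s, g i ≫ c.inj i) :
    IsCompactObject.{u} X := by
  classical
  intro I Y c hc
  constructor
  · rw [injective_iff_map_eq_zero]
    intro a ha
    let p (i : I) : c.pt ⟶ Y i := Cofan.IsColimit.desc hc
      (fun j => if h : j = i then eqToHom (congrArg Y h) else 0)
    have hp (i : I) : c.inj i ≫ p i = 𝟙 _ := by simp [p]
    have hp' (i j : I) (h : j ≠ i) : c.inj j ≫ p i = 0 := by simp [p, h]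
    ext i
    -- The projection `p i` recovers the `i`-th coordinate of an element of the direct sum, so the
    -- kernel of the comparison map is zero.
    have key : (Preadditive.rightComp X (p i)).comp (coproductComparison X c) =
        DFinsupp.evalAddMonoidHom (β := fun i => X ⟶ Y i) i := by
      refine DirectSum.addHom_ext fun j f => ?_
      rw [AddMonoidHom.comp_apply, coproductComparison_of]
      change (f ≫ c.inj j) ≫ p i = DirectSum.of (fun i => X ⟶ Y i) j f i
      rw [Category.assoc]
      by_cases h : j = i
      · subst h
        rw [hp, DirectSum.of_eq_same, Category.comp_id]
      · rw [hp' i j h, DirectSum.of_eq_of_ne _ _ _ (Ne.symm h), comp_zero]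
    have := DFunLike.congr_fun key a
    simp only [AddMonoidHom.comp_apply, ha, map_zero] at this
    exact this.symm
  · intro f
    obtain ⟨s, g, rfl⟩ := H I Y c hc f
    refine ⟨∑ i ∈ s, DirectSum.of (fun i => X ⟶ Y i) i (g i), ?_⟩
    rw [map_sum]
    exact Finset.sum_congr rfl fun i _ => coproductComparison_of X c i _

lemma IsCompactObject.exists_sum {X : T} (hX : IsCompactObject.{u} X) {I : Type u} {Y : I → T}
    {c : Cofan Y} (hc : IsColimit c) (f : X ⟶ c.pt) :
    ∃ (s : Finset I) (g : ∀ i, X ⟶ Y i), f = ∑ i ∈ s, g i ≫ c.inj i := by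
  classical
  obtain ⟨a, rfl⟩ := (hX I Y c hc).2 f
  refine ⟨DFinsupp.support a, fun i => a i, ?_⟩
  conv_lhs => rw [← DirectSum.sum_support_of a, map_sum]
  exact Finset.sum_congr rfl fun i _ => coproductComparison_of X c i _

variable [HasZeroObject T]

lemma IsCompactObject.of_iso {X X' : T} (e : X ≅ X') (hX : IsCompactObject.{u} X) :
    IsCompactObject.{u} X' :=
  isCompactObject_of_exists_sum fun I Y c hc f => by
    obtain ⟨s, g, hg⟩ := hX.exists_sum hc (e.hom ≫ f)
    refine ⟨s, fun i => e.inv ≫ g i, ?_⟩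
    rw [← cancel_epi e.hom, hg, Preadditive.comp_sum]
    simp

/-- Used to transport compactness along the equivalence with graded vector spaces. -/
lemma IsCompactObject.of_map {T' : Type*} [Category T'] [Preadditive T'] (F : T ⥤ T')
    [F.Full] [F.Faithful] [F.Additive] [∀ I : Type u, PreservesColimitsOfShape (Discrete I) F]
    {X : T} (hX : IsCompactObject.{u} (F.obj X)) : IsCompactObject.{u} X :=
  isCompactObject_of_exists_sum fun I Y c hc f => by
    obtain ⟨s, g, hg⟩ := hX.exists_sum (c := Cofan.mk (F.obj c.pt) (fun i => F.map (c.inj i)))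
      (isColimitCofanMkObjOfIsColimit F Y c.inj hc) (F.map f)
    refine ⟨s, fun i => F.preimage (g i), F.map_injective ?_⟩
    rw [hg, F.map_sum]
    exact Finset.sum_congr rfl fun i _ => by simp

end Compact

/-- Replacing the objects of a coproduct by isomorphic ones. -/
def isColimitCofanMkOfIso {C I : Type*} [Category C] {Y Y' : I → C} {c : Cofan Y} (hc : IsColimit c)
    (e : ∀ i, Y' i ≅ Y i) {P : C} (e' : c.pt ≅ P) :
    IsColimit (Cofan.mk P (fun i => (e i).hom ≫ c.inj i ≫ e'.hom)) :=
  Cofan.IsColimit.mk _ (fun s => e'.inv ≫ Cofan.IsColimit.desc hc (fun i => (e i).inv ≫ s.inj i))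
    (fun s i => by simp)
    (fun s m hm => by
      rw [← cancel_epi e'.hom]
      refine Cofan.IsColimit.hom_ext hc _ _ fun i => ?_
      rw [← cancel_epi (e i).hom]
      simpa using hm i)

/-! ### The derived category of a field -/

section
variable (k : Type u) [Field k]

/-- The quotient of the coproduct by the sum of the images of its summands receives the zero map
from each summand, so the quotient map is zero and the images span. -/
lemma ModuleCat.exists_eq_sum_of_isColimit {R : Type*} [Ring R] {I : Type*}
    {V : I → ModuleCat.{u} R} {c : Cofan V} (hc : IsColimit c) (x : c.pt) :
    ∃ (s : Finset I) (y : ∀ i, V i), x = ∑ i ∈ s, (c.inj i).hom (y i) := by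
  let p : Submodule R c.pt := ⨆ i, LinearMap.range (c.inj i).hom
  have h0 : ModuleCat.ofHom p.mkQ = 0 := by
    refine Cofan.IsColimit.hom_ext hc _ _ fun i => ?_
    ext y
    exact (Submodule.Quotient.mk_eq_zero p).2
      (Submodule.mem_iSup_of_mem i (LinearMap.mem_range_self _ y))
  have hx : x ∈ p := (Submodule.Quotient.mk_eq_zero p).1 (congrArg (fun f => f.hom x) h0)
  obtain ⟨f, hf, rfl⟩ := (Submodule.mem_iSup_iff_exists_finsupp _ _).1 hx
  choose y hy using hf
  exact ⟨f.support, y, Finset.sum_congr rfl fun i _ => (hy i).symm⟩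

/-- Evaluation of graded morphisms at an index, as an additive map. -/
def CategoryTheory.GradedObject.evalAddHom {J C : Type*} [Category C] [Preadditive C]
    (X Y : GradedObject J C) (j : J) : (X ⟶ Y) →+ (X j ⟶ Y j) where
  toFun f := f j
  map_zero' := rfl
  map_add' _ _ := rfl

/-- Maps out of the line in degree `n` are elements of degree `n`, and an element of a coproduct is
a finite sum of elements of the summands. -/
lemma isCompactObject_gradedLine (n : ℤ) : IsCompactObject.{u} (gradedLine k n) :=
  isCompactObject_of_exists_sum fun I Y c hc f => by
    obtain ⟨s, y, hy⟩ := ModuleCat.exists_eq_sum_of_isColimit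
      (GradedObject.isColimitCofanEval c hc n) ((f n).hom (gradedLineGen k n))
    refine ⟨s, fun i => gradedLineHom k (y i), gradedLine_hom_ext k (hy.trans ?_)⟩
    have h1 := map_sum (GradedObject.evalAddHom (gradedLine k n) c.pt n)
      (fun i => gradedLineHom k (y i) ≫ c.inj i) s
    refine Eq.trans ?_ (congrArg (fun g => g.hom (gradedLineGen k n)) h1).symm
    rw [ModuleCat.hom_sum, LinearMap.sum_apply]
    exact Finset.sum_congr rfl fun i _ => (gradedLineHom_comp k (y i) (c.inj i)).symm

variable {k} in
open HomologicalComplex in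
-- `K.X i ⊗ L.X j` is a retract of the tensor complex in degree `i + j`.
lemma isZero_tensor_X {K L : CochainComplex (ModuleCat.{u} k) ℤ} (i j : ℤ)
    (h : IsZero ((K ⊗ L).X (i + j))) : IsZero (K.X i ⊗ L.X j) := by
  classical
  let p : (K ⊗ L).X (i + j) ⟶ K.X i ⊗ L.X j :=
    mapBifunctorDesc (K₁ := K) (K₂ := L) (F := curriedTensor (ModuleCat.{u} k))
      (c := ComplexShape.up ℤ) (fun a b _ =>
        if h : a = i ∧ b = j then eqToHom (by rw [h.1, h.2]; rfl) else 0)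
  have hp : ιTensorObj K L i j (i + j) rfl ≫ p = 𝟙 _ := by
    refine (ι_mapBifunctorDesc _ _ _ _).trans ?_
    rw [dif_pos ⟨rfl, rfl⟩]
    rfl
  rw [IsZero.iff_id_eq_zero, ← hp, h.eq_of_src p 0, comp_zero]

variable [HasDerivedCategory.{w} (ModuleCat.{u} k)]

/-- The vector space `k`, as an object of the derived category in degree `n`. -/
noncomputable abbrev derivedLine (n : ℤ) : DerivedCategory (ModuleCat.{u} k) :=
  (DerivedCategory.singleFunctor (ModuleCat.{u} k) n).obj (ModuleCat.of k k)

instance : (gradedToDerived k).inv.Additive :=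
  have : (gradedToDerived k).asEquivalence.functor.Additive :=
    inferInstanceAs (gradedToDerived k).Additive
  (gradedToDerived k).asEquivalence.inverse_additive

lemma isCompactObject_derivedLine (n : ℤ) : IsCompactObject.{u} (derivedLine k n) := by
  refine IsCompactObject.of_map (gradedToDerived k).inv ((isCompactObject_gradedLine k n).of_iso ?_)
  exact (gradedToDerived k).asEquivalence.unitIso.app _ ≪≫
    (gradedToDerived k).inv.mapIso (gradedToDerivedGradedLineIso k n)

lemma isZero_gradedToDerived_iff (G : GradedObject ℤ (ModuleCat.{u} k)) :
    IsZero ((gradedToDerived k).obj G) ↔ ∀ n (x : G n), x = 0 := by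
  rw [IsZero.iff_id_eq_zero, ← CategoryTheory.Functor.map_id, Functor.map_eq_zero_iff]
  constructor
  · intro h n x
    exact congrArg (fun f => (f n).hom x) h
  · intro h
    funext n
    ext x
    exact h n x

lemma isZero_of_forall_derivedLine_hom_eq_zero {X : DerivedCategory (ModuleCat.{u} k)}
    (h : ∀ (n : ℤ) (f : derivedLine k n ⟶ X), f = 0) : IsZero X := by
  let e := (gradedToDerived k).objObjPreimageIso X
  refine ((isZero_gradedToDerived_iff k _).2 fun n x => ?_).of_iso e.symm
  have h1 := h n ((gradedToDerivedGradedLineIso k n).inv ≫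
    (gradedToDerived k).map (gradedLineHom k x) ≫ e.hom)
  rw [Preadditive.IsIso.comp_left_eq_zero, Preadditive.IsIso.comp_right_eq_zero,
    Functor.map_eq_zero_iff] at h1
  exact (gradedLineHom_gen k x).symm.trans (congrArg (fun f => (f n).hom (gradedLineGen k n)) h1)

lemma isZero_of_forall_shift {X : DerivedCategory (ModuleCat.{u} k)}
    (h : ∀ (n : ℤ) (f : derivedLine k 0 ⟶ X⟦n⟧), f = 0) : IsZero X :=
  isZero_of_forall_derivedLine_hom_eq_zero k fun n f => by
    -- Shifting `f` by `n` turns the line in degree `n` into the line in degree `0`.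
    have h1 := h n ((((DerivedCategory.singleFunctors (ModuleCat.{u} k)).shiftIso n 0 n
      (add_zero n)).app _).inv ≫ f⟦n⟧')
    rw [Preadditive.IsIso.comp_left_eq_zero, Functor.map_eq_zero_iff] at h1
    exact h1

lemma exists_isColimit_derivedLine (X : DerivedCategory (ModuleCat.{u} k)) :
    ∃ (I : Type u) (n : I → ℤ) (i : ∀ a, derivedLine k (n a) ⟶ X),
      Nonempty (IsColimit (Cofan.mk X i)) := by
  let F := gradedToDerived k
  let G := F.objPreimage X
  let c := basisCofan k G
  have hc := isColimitCofanMkObjOfIsColimit F _ c.inj (isColimitBasisCofan k G)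
  exact ⟨_, fun i => i.1, fun i => (gradedToDerivedGradedLineIso k i.1).inv ≫ F.map (c.inj i) ≫
    (F.objObjPreimageIso X).hom, ⟨isColimitCofanMkOfIso hc
      (fun i => (gradedToDerivedGradedLineIso k i.1).symm) (F.objObjPreimageIso X)⟩⟩

lemma not_isZero_derivedLine (n : ℤ) : ¬ IsZero (derivedLine k n) := by
  intro h
  have h1 : IsZero (ModuleCat.of k k) := by
    rw [IsZero.iff_id_eq_zero, ← Functor.map_eq_zero_iff
      (DerivedCategory.singleFunctor (ModuleCat.{u} k) n), CategoryTheory.Functor.map_id]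
    exact h.eq_of_src _ _
  have := ModuleCat.subsingleton_of_isZero h1
  exact not_subsingleton k this

/-- The unit of the derived category is `k` in degree `0`. -/
noncomputable def derivedUnitIso : 𝟙_ (DerivedCategory (ModuleCat.{u} k)) ≅ derivedLine k 0 :=
  Functor.Monoidal.εIso (DerivedCategory.Q (C := ModuleCat.{u} k))

lemma isZero_of_d_eq_zero {K : CochainComplex (ModuleCat.{u} k) ℤ} (hK : ∀ i j, K.d i j = 0)
    (h : IsZero (DerivedCategory.Q.obj K)) (n : ℤ) : IsZero (K.X n) := by
  have : IsIso (K.iCycles n) := K.isIso_iCycles n _ rfl (hK _ _)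
  have : IsIso (K.homologyπ n) := K.isIso_homologyπ _ n rfl (hK _ _)
  have h1 : IsZero (K.homology n) :=
    ((DerivedCategory.homologyFunctor _ n).map_isZero h).of_iso
      ((DerivedCategory.homologyFunctorFactors _ n).app K).symm
  exact h1.of_iso ((asIso (K.iCycles n)).symm ≪≫ asIso (K.homologyπ n))

/-- Both objects may be replaced by complexes with zero differential. Their tensor product then has
zero differential too, so it vanishes in the derived category only if each `G i ⊗ H j` does; and a
tensor product of nonzero vector spaces is nonzero. -/
lemma derived_isZero_tensor_iff (X Y : DerivedCategory (ModuleCat.{u} k)) :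
    IsZero (X ⊗ Y) ↔ IsZero X ∨ IsZero Y := by
  constructor
  · intro h
    let F := gradedToDerived k
    let G := F.objPreimage X
    let H := F.objPreimage Y
    let K := (zeroDifferential k).obj G
    let L := (zeroDifferential k).obj H
    let eX : DerivedCategory.Q.obj K ≅ X := F.objObjPreimageIso X
    let eY : DerivedCategory.Q.obj L ≅ Y := F.objObjPreimageIso Y
    have h1 : IsZero (DerivedCategory.Q.obj (K ⊗ L)) :=
      h.of_iso ((Functor.Monoidal.μIso DerivedCategory.Q K L).symm ≪≫ (eX ⊗ᵢ eY))
    have hd (i j : ℤ) : (K ⊗ L).d i j = 0 := by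
      by_cases hij : i + 1 = j
      · refine KoszulBraiding.hom_ext' _ _ fun a b hab => ?_
        rw [KoszulBraiding.ι_d K L a b i j hab hij, show K.d a (a + 1) = 0 from rfl,
          show L.d b (b + 1) = 0 from rfl]
        simp
      · exact (K ⊗ L).shape i j hij
    have h2 (i j : ℤ) : IsZero (G i ⊗ H j) :=
      isZero_tensor_X (K := K) (L := L) i j (isZero_of_d_eq_zero k hd h1 (i + j))
    by_cases hG : ∀ n (x : G n), x = 0
    · exact Or.inl (((isZero_gradedToDerived_iff k G).2 hG).of_iso eX.symm)
    · push Not at hG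
      obtain ⟨n, x, hx⟩ := hG
      refine Or.inr (((isZero_gradedToDerived_iff k H).2 fun m y => ?_).of_iso eY.symm)
      by_contra hy
      have := nontrivial_of_ne x 0 hx
      have := nontrivial_of_ne y 0 hy
      have h3 : Subsingleton (TensorProduct k (G n) (H m)) :=
        ModuleCat.subsingleton_of_isZero (h2 n m)
      exact not_subsingleton _ h3
  · rintro (h | h)
    · rw [IsZero.iff_id_eq_zero, ← id_whiskerRight, h.eq_of_src (𝟙 X) 0,
        MonoidalPreadditive.zero_whiskerRight]
    · rw [IsZero.iff_id_eq_zero, ← whiskerLeft_id, h.eq_of_src (𝟙 Y) 0,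
        MonoidalPreadditive.whiskerLeft_zero]

end

/-! ### Graded objects of a preadditive category -/

namespace CategoryTheory.GradedObject

variable {J C : Type*} [Category C]

variable [Preadditive C]

lemma isZero_iff (X : GradedObject J C) : IsZero X ↔ ∀ j, IsZero (X j) := by
  simp only [IsZero.iff_id_eq_zero]
  exact ⟨fun h j => congrFun h j, fun h => funext h⟩

variable [HasInitial C] [DecidableEq J]

/-- The map out of `(single j).obj V` determined by a map out of `V`. -/
noncomputable def singleDesc {j : J} {V : C} {X : GradedObject J C} (f : V ⟶ X j) :
    (single j).obj V ⟶ X := fun i =>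
  if h : i = j then (singleObjApplyIsoOfEq j V i h).hom ≫ f ≫ eqToHom (by rw [h]) else 0

lemma singleDesc_apply {j : J} {V : C} {X : GradedObject J C} (f : V ⟶ X j) :
    singleDesc f j = (singleObjApplyIso j V).hom ≫ f := by
  simp [singleDesc]

lemma inv_singleDesc_apply {j : J} {V : C} {X : GradedObject J C} (f : V ⟶ X j) :
    (singleObjApplyIso j V).inv ≫ singleDesc f j = f := by
  rw [singleDesc_apply, Iso.inv_hom_id_assoc]

lemma eq_zero_of_singleDesc_eq_zero {j : J} {V : C} {X : GradedObject J C} {f : V ⟶ X j}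
    (h : singleDesc f = 0) : f = 0 := by
  rw [← inv_singleDesc_apply f, h]
  exact comp_zero

/-- Maps out of `(single j).obj V` are maps from `V` to the component `j`, and that component of a
coproduct is the coproduct of the components. -/
lemma isCompactObject_single [HasZeroObject C]
    (j : J) {V : C} (hV : IsCompactObject.{u} V) : IsCompactObject.{u} ((single j).obj V) :=
  isCompactObject_of_exists_sum fun I Y c hc f => by
    obtain ⟨s, g, hg⟩ := hV.exists_sum (isColimitCofanEval c hc j)
      ((singleObjApplyIso j V).inv ≫ f j)
    refine ⟨s, fun i => singleDesc (g i), single_hom_ext ?_⟩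
    rw [← cancel_epi (singleObjApplyIso j V).inv]
    refine hg.trans (Eq.trans ?_ (congrArg (_ ≫ ·) (map_sum (evalAddHom _ _ j) _ s)).symm)
    rw [Preadditive.comp_sum]
    refine Finset.sum_congr rfl fun i _ => ?_
    exact ((Category.assoc _ _ _).symm.trans
      (congrArg (· ≫ c.inj i j) (inv_singleDesc_apply (g i)))).symm

/-- A cofan consisting of zero objects is a coproduct. -/
def isColimitOfIsZero {I : Type*} {Y : I → C} (c : Cofan Y) (hY : ∀ i, IsZero (Y i))
    (hc : IsZero c.pt) : IsColimit c :=
  Cofan.IsColimit.mk c (fun _ => 0) (fun _ i => (hY i).eq_of_src _ _)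
    (fun _ _ _ => hc.eq_of_src _ _)

/-- A graded object concentrated in degree `j` is the coproduct of the `single j` of the summands
of its component of degree `j`. -/
noncomputable def isColimitSingleCofan {I : Type*} {j : J} {X : GradedObject J C} {Y : I → C}
    {f : ∀ i, Y i ⟶ X j} (hf : IsColimit (Cofan.mk (X j) f)) (hX : ∀ i ≠ j, IsZero (X i)) :
    IsColimit (Cofan.mk (f := fun i => (single j).obj (Y i)) X (fun i => singleDesc (f i))) :=
  isColimitOfCofanEval _ fun a =>
    if h : a = j then by
      subst h
      exact (isColimitCofanMkOfIso hf (fun i => singleObjApplyIso a (Y i)) (Iso.refl _)).ofIsoColimit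
        (Cofan.ext (Iso.refl _) fun i => by
          refine (Category.comp_id _).trans (Eq.trans ?_ (singleDesc_apply (f i)).symm)
          exact congrArg (_ ≫ ·) (Category.comp_id _))
    else isColimitOfIsZero _ (fun i => isZero_single_apply j (Y i) h) (hX a h)

lemma isZero_tensor_apply_iff {J C : Type*} [AddMonoid J] [Category C] [Preadditive C]
    [MonoidalCategory C] (X Y : GradedObject J C) [HasTensor X Y] (c : J) :
    IsZero (Monoidal.tensorObj X Y c) ↔ ∀ a b, a + b = c → IsZero (X a ⊗ Y b) := by
  classical
  constructor
  · intro h a b hab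
    let p : Monoidal.tensorObj X Y c ⟶ X a ⊗ Y b := Monoidal.tensorObjDesc fun a' b' _ =>
      if h : a' = a ∧ b' = b then eqToHom (by rw [h.1, h.2]) else 0
    have hp : Monoidal.ιTensorObj X Y a b c hab ≫ p = 𝟙 _ := by simp [p]
    rw [IsZero.iff_id_eq_zero, ← hp, h.eq_of_src p 0, comp_zero]
  · intro h
    rw [IsZero.iff_id_eq_zero]
    exact Monoidal.tensorObj_ext _ _ fun a b hab => (h a b hab).eq_of_src _ _

/-- If all other summands of a component vanish, the projection to the remaining one is a two-sided
inverse of its inclusion. -/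
lemma isIso_ιTensorObj {J C : Type*} [AddMonoid J] [Category C] [Preadditive C]
    [MonoidalCategory C] (X Y : GradedObject J C) [HasTensor X Y] (a b c : J) (hab : a + b = c)
    (h : ∀ a' b', a' + b' = c → ¬ (a' = a ∧ b' = b) → IsZero (X a' ⊗ Y b')) :
    IsIso (Monoidal.ιTensorObj X Y a b c hab) := by
  classical
  let p : Monoidal.tensorObj X Y c ⟶ X a ⊗ Y b := Monoidal.tensorObjDesc fun a' b' _ =>
    if h : a' = a ∧ b' = b then eqToHom (by rw [h.1, h.2]) else 0
  have hp : Monoidal.ιTensorObj X Y a b c hab ≫ p = 𝟙 _ := by simp [p]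
  refine ⟨p, hp, Monoidal.tensorObj_ext _ _ fun a' b' hab' => ?_⟩
  by_cases h' : a' = a ∧ b' = b
  · obtain ⟨rfl, rfl⟩ := h'
    rw [← Category.assoc, hp, Category.id_comp, Category.comp_id]
  · exact (h a' b' hab' h').eq_of_src _ _

end CategoryTheory.GradedObject

/-! ### The category `TM k` -/

section
variable (k : Type u) [Field k] [HasDerivedCategory.{w} (ModuleCat.{u} k)]

open GradedObject Pretriangulated

local notation "e₁" => Additive.ofMul TwoMonoid.one
local notation "eₘ" => Additive.ofMul TwoMonoid.m

/-! ### Vanishing of tensor products in `TM k`. -/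

variable {k} in
lemma tm_isZero_iff (X : TM k) : IsZero X ↔ IsZero (X e₁) ∧ IsZero (X eₘ) := by
  rw [GradedObject.isZero_iff]
  exact ⟨fun h => ⟨h _, h _⟩, fun h j => match j with
    | .one => h.1
    | .m => h.2⟩

variable {k} in
lemma tm_isZero_tensor_one_iff (X Y : TM k) :
    IsZero ((X ⊗ Y) e₁) ↔ IsZero (X e₁) ∨ IsZero (Y e₁) := by
  refine (isZero_tensor_apply_iff X Y e₁).trans ?_
  rw [← derived_isZero_tensor_iff]
  exact ⟨fun h => h _ _ rfl, fun h a b hab => match a, b, hab with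
    | .one, .one, _ => h⟩

variable {k} in
lemma tm_isZero_tensor_m_iff (X Y : TM k) :
    IsZero ((X ⊗ Y) eₘ) ↔ IsZero (X e₁ ⊗ Y eₘ) ∧ IsZero (X eₘ ⊗ Y e₁) ∧ IsZero (X eₘ ⊗ Y eₘ) := by
  refine (isZero_tensor_apply_iff X Y eₘ).trans ?_
  exact ⟨fun h => ⟨h _ _ rfl, h _ _ rfl, h _ _ rfl⟩, fun h a b hab => match a, b, hab with
    | .one, .m, _ => h.1
    | .m, .one, _ => h.2.1
    | .m, .m, _ => h.2.2⟩

variable {k} in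
-- If `X_a` and `Y_b` are nonzero, then `X_a ⊗ Y_b` is a nonzero summand of the component of index
-- `a * b`.
lemma tm_isZero_tensor_iff (X Y : TM k) : IsZero (X ⊗ Y) ↔ IsZero X ∨ IsZero Y := by
  rw [tm_isZero_iff (X ⊗ Y), tm_isZero_tensor_one_iff, tm_isZero_tensor_m_iff, tm_isZero_iff X,
    tm_isZero_iff Y]
  simp only [derived_isZero_tensor_iff]
  tauto

/-- The component of `kObj k j` of index `j`. -/
noncomputable def kObjApplyIso (j : TwoMonoid) :
    kObj k j (Additive.ofMul j) ≅ derivedLine k 0 :=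
  singleObjApplyIso (Additive.ofMul j) (derivedLine k 0)

lemma not_isZero_kObj (j : TwoMonoid) : ¬ IsZero (kObj k j) := fun h =>
  not_isZero_derivedLine k 0
    (((GradedObject.isZero_iff _).1 h (Additive.ofMul j)).of_iso (kObjApplyIso k j).symm)

lemma isZero_kObj_m_one : IsZero (kObj k .m e₁) :=
  isZero_single_apply (eₘ : Additive TwoMonoid) _ (fun h => nomatch h)

lemma isZero_kObj_one_m : IsZero (kObj k .one eₘ) :=
  isZero_single_apply (e₁ : Additive TwoMonoid) _ (fun h => nomatch h)

lemma not_isZero_kObj_one_one : ¬ IsZero (kObj k .one e₁) := fun h =>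
  not_isZero_derivedLine k 0 (h.of_iso (kObjApplyIso k .one).symm)

/-- The unit of `TM k` is `k_1`. -/
noncomputable def tmUnitIso : 𝟙_ (TM k) ≅ kObj k .one :=
  (GradedObject.single (e₁ : Additive TwoMonoid)).mapIso (derivedUnitIso k)

lemma nonempty_kObj_m_tensor_iso : Nonempty (kObj k .m ⊗ kObj k .m ≅ kObj k .m) := by
  have h₁ := isZero_kObj_m_one k
  have hιiso : IsIso (Monoidal.ιTensorObj (kObj k .m) (kObj k .m) eₘ eₘ eₘ rfl) :=
    isIso_ιTensorObj _ _ _ _ _ _ fun a b hab hne => match a, b, hab, hne with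
      | .one, _, _, _ => (derived_isZero_tensor_iff k _ _).2 (Or.inl h₁)
      | .m, .one, _, _ => (derived_isZero_tensor_iff k _ _).2 (Or.inr h₁)
      | .m, .m, _, hne => absurd ⟨rfl, rfl⟩ hne
  let e := kObjApplyIso k .m
  let eM : (kObj k .m ⊗ kObj k .m) eₘ ≅ kObj k .m eₘ :=
    (@asIso _ _ _ _ _ hιiso).symm ≪≫ (e ⊗ᵢ (e ≪≫ (derivedUnitIso k).symm)) ≪≫ ρ_ _ ≪≫ e.symm
  have hz : IsZero ((kObj k .m ⊗ kObj k .m) e₁) :=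
    (tm_isZero_tensor_one_iff _ _).2 (Or.inl h₁)
  exact ⟨GradedObject.isoMk _ _ fun j => match j with
    | .one => hz.iso h₁
    | .m => eM⟩

/-! #### Bousfield classes -/

variable {k} in
lemma bousfieldClass_of_isZero {X : TM k} (h : IsZero X) : bousfieldClass X = ⊤ := by
  ext Y
  exact iff_of_true ((tm_isZero_tensor_iff X Y).2 (Or.inl h)) trivial

variable {k} in
lemma bousfieldClass_of_not_isZero {X : TM k} (h : ¬ IsZero X) :
    bousfieldClass X = fun Y => IsZero Y := by
  ext Y
  exact (tm_isZero_tensor_iff X Y).trans (or_iff_right h)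

lemma bousfieldClass_zero_ne : bousfieldClass (0 : TM k) ≠ bousfieldClass (kObj k .one) := by
  rw [bousfieldClass_of_isZero (isZero_zero _), bousfieldClass_of_not_isZero (not_isZero_kObj k _)]
  intro h
  have h1 : (fun Y : TM k => IsZero Y) (kObj k .one) := by
    rw [← h]
    trivial
  exact not_isZero_kObj k .one h1

lemma bousfieldClass_eq_or (X : TM k) :
    bousfieldClass X = bousfieldClass 0 ∨ bousfieldClass X = bousfieldClass (kObj k .one) := by
  by_cases h : IsZero X
  · exact Or.inl (by rw [bousfieldClass_of_isZero h, bousfieldClass_of_isZero (isZero_zero _)])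
  · exact Or.inr (by rw [bousfieldClass_of_not_isZero h,
      bousfieldClass_of_not_isZero (not_isZero_kObj k .one)])

lemma range_bousfieldClass : Set.range (bousfieldClass (T := TM k)) =
    {bousfieldClass 0, bousfieldClass (kObj k .one)} := by
  ext P
  constructor
  · rintro ⟨X, rfl⟩
    exact bousfieldClass_eq_or k X
  · rintro (rfl | rfl)
    exacts [⟨_, rfl⟩, ⟨_, rfl⟩]

lemma nonempty_bousfieldLattice_orderIso : Nonempty (BousfieldLattice (TM k) ≃o Bool) := by
  let f : Bool → BousfieldLattice (TM k) := fun b =>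
    ⟨OrderDual.toDual (bousfieldClass (cond b (kObj k .one) 0)), _, rfl⟩
  have hlt : f false < f true := by
    refine lt_of_le_of_ne ?_ fun h => bousfieldClass_zero_ne k (congrArg Subtype.val h)
    -- The order is reverse inclusion, so the largest class `A(0)` is the bottom element.
    change bousfieldClass (kObj k .one) ≤ bousfieldClass (0 : TM k)
    rw [bousfieldClass_of_isZero (isZero_zero _)]
    exact le_top
  have hmono : StrictMono f := by
    rintro (_ | _) (_ | _) h
    exacts [absurd h (lt_irrefl _), hlt, absurd h (by decide), absurd h (lt_irrefl _)]
  refine ⟨(hmono.orderIsoOfSurjective f ?_).symm⟩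
  rintro ⟨P, X, hX⟩
  rcases bousfieldClass_eq_or k X with h | h
  · exact ⟨false, Subtype.ext (h.symm.trans hX)⟩
  · exact ⟨true, Subtype.ext (h.symm.trans hX)⟩

/-! #### The localizing subcategory generated by `k_m` -/

lemma isLocalizing_isZero_apply (j : Additive TwoMonoid) :
    IsLocalizing.{u} (fun X : TM k => IsZero (X j)) where
  isTriangulated :=
    { exists_zero := ⟨0, isZero_zero _, (GradedObject.isZero_iff _).1 (isZero_zero (TM k)) j⟩
      isStableUnderShiftBy := fun n => ⟨fun _ hX =>
        (shiftFunctor (DerivedCategory (ModuleCat.{u} k)) n).map_isZero hX⟩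
      ext₂' := fun T hT h₁ h₃ => ObjectProperty.le_isoClosure _ _
        ((LevelwiseTriangulated.component T j).isZero₂_of_isZero₁₃ (hT j) h₁ h₃) }
  isClosedUnderIsomorphisms := ⟨fun e hX => hX.of_iso ((GradedObject.eval j).mapIso e).symm⟩
  coproducts _ := ⟨fun _ ⟨h⟩ => (IsZero.iff_id_eq_zero _).2
    ((isColimitOfPreserves (GradedObject.eval j) h.isColimit).hom_ext fun i =>
      (h.prop_diag_obj i).eq_of_src _ _)⟩

/-- The object `k` in degree `n` is a shift of the object `k` in degree `0`, also in `TM k`. -/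
lemma nonempty_single_derivedLine_iso (j : TwoMonoid) (n : ℤ) :
    Nonempty ((kObj k j)⟦-n⟧ ≅
      (GradedObject.single (Additive.ofMul j)).obj (derivedLine k n)) := by
  have h (i : Additive TwoMonoid) : Nonempty (((kObj k j)⟦-n⟧ : TM k) i ≅
      (GradedObject.single (Additive.ofMul j)).obj (derivedLine k n) i) := by
    by_cases hi : i = Additive.ofMul j
    · rw [hi]
      exact ⟨(shiftFunctor (DerivedCategory (ModuleCat.{u} k)) (-n)).mapIso (kObjApplyIso k j) ≪≫
        ((DerivedCategory.singleFunctors (ModuleCat.{u} k)).shiftIso (-n) n 0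
          (neg_add_cancel n)).app _ ≪≫ (singleObjApplyIso _ _).symm⟩
    · exact ⟨((shiftFunctor (DerivedCategory (ModuleCat.{u} k)) (-n)).map_isZero
        (isZero_single_apply _ _ hi)).iso (isZero_single_apply _ _ hi)⟩
  exact ⟨GradedObject.isoMk _ _ fun i => (h i).some⟩

/-- The objects with zero component `1` form a localizing subcategory containing `k_m`. Conversely,
such an object is concentrated in index `m`, where it is a coproduct of shifts of `k`; so it is a
coproduct of shifts of `k_m`. -/
lemma loc_kObj_m_eq : loc.{u} (kObj k .m) = fun X : TM k => IsZero (X e₁) := by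
  ext X
  constructor
  · exact fun h => h _ (isLocalizing_isZero_apply k e₁) (isZero_kObj_m_one k)
  · intro hX P hP hk
    obtain ⟨I, n, i, ⟨hc⟩⟩ := exists_isColimit_derivedLine k (X eₘ)
    have hX' : ∀ j ≠ (eₘ : Additive TwoMonoid), IsZero (X j) := fun j hj => match j, hj with
      | .one, _ => hX
      | .m, hj => absurd rfl hj
    have := hP.coproducts I
    have := hP.isClosedUnderIsomorphisms
    have := hP.isTriangulated
    refine P.prop_of_isColimit (isColimitSingleCofan hc hX') fun a => ?_
    exact P.prop_of_iso (nonempty_single_derivedLine_iso k .m (n a.as)).some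
      (P.le_shift (-n a.as) _ hk)

lemma loc_kObj_m_iff (X : TM k) : loc.{u} (kObj k .m) X ↔ IsZero (X e₁) := by
  rw [loc_kObj_m_eq]

/-- `k_1` separates `loc(k_m)` from the class of all objects, and `k_m` separates it from the class
of zero objects. -/
lemma loc_kObj_m_ne_bousfieldClass (X : TM k) : bousfieldClass X ≠ loc.{u} (kObj k .m) := by
  rw [loc_kObj_m_eq]
  intro h
  by_cases hX : IsZero X
  · rw [bousfieldClass_of_isZero hX] at h
    have h1 : (⊤ : ObjectProperty (TM k)) (kObj k .one) := trivial
    rw [h] at h1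
    exact not_isZero_kObj_one_one k h1
  · rw [bousfieldClass_of_not_isZero hX] at h
    have h1 : (fun X : TM k => IsZero (X e₁)) (kObj k .m) := isZero_kObj_m_one k
    rw [← h] at h1
    exact not_isZero_kObj k .m h1

/-! #### Compact and rigid objects -/

lemma isCompactObject_kObj (j : TwoMonoid) : IsCompactObject.{u} (kObj k j) :=
  isCompactObject_single _ (isCompactObject_derivedLine k 0)

/-- The generators are `k_1` and `k_m`: maps `k_j ⟶ X⟦n⟧` are maps from `k` to the `n`-th shift of
`X_j`, and these detect whether `X_j` is zero. -/
lemma tm_isCompactlyGenerated : IsCompactlyGeneratedTriangulated.{u} (TM k) where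
  hasCoproducts _ := inferInstance
  exists_generators := ⟨ULift TwoMonoid, fun j => kObj k j.down,
    fun j => isCompactObject_kObj k j.down, fun X h => (GradedObject.isZero_iff X).2 fun j =>
      isZero_of_forall_shift k fun n f =>
        eq_zero_of_singleDesc_eq_zero (X := X⟦n⟧) (h ⟨j.toMul⟩ n (singleDesc (X := X⟦n⟧) f))⟩

lemma not_isDualizable_kObj_m : ¬ IsDualizable (kObj k .m) := by
  rintro ⟨Y, ⟨hY⟩⟩
  have h₁ := isZero_kObj_m_one k
  have hz : IsZero ((kObj k .m ⊗ Y) e₁) := (tm_isZero_tensor_one_iff _ _).2 (Or.inl h₁)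
  have hu : IsZero ((𝟙_ (TM k)) eₘ) :=
    (isZero_kObj_one_m k).of_iso ((GradedObject.eval _).mapIso (tmUnitIso k))
  -- In component `1` the target of the coevaluation is zero, in component `m` its source. A
  -- triangle identity then makes an isomorphism out of a zero map, so `k_m` would be zero.
  have hη : η_ (kObj k .m) Y = 0 := funext fun j => match j with
    | .one => hz.eq_of_tgt _ _
    | .m => hu.eq_of_src _ _
  have hw : (0 : 𝟙_ (TM k) ⟶ kObj k .m ⊗ Y) ▷ kObj k .m = 0 := by
    have h0 : IsZero ((0 : TM k) ⊗ kObj k .m) :=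
      (tm_isZero_tensor_iff _ _).2 (Or.inl (isZero_zero _))
    -- The zero map is factored through the zero object, whose product with `k_m` is again zero;
    -- additivity of whiskering in `TM k` is not needed.
    rw [← comp_zero (X := 𝟙_ (TM k)) (Y := 0) (f := 0), comp_whiskerRight,
      h0.eq_of_tgt (_ ▷ _) 0, zero_comp]
  have h := ExactPairing.evaluation_coevaluation (kObj k .m) Y
  rw [hη, hw, zero_comp] at h
  refine not_isZero_kObj k .m ((IsZero.iff_id_eq_zero _).2 ?_)
  rw [← cancel_epi (λ_ _).hom, ← cancel_mono (ρ_ _).inv, Category.comp_id, ← h, comp_zero,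
    zero_comp]

/-! #### Localization away from `loc(k_m)` -/

variable {k} in
/-- The component of index `1` of an object, completed by zero. -/
noncomputable def truncObj (X : TM k) : TwoMonoid → DerivedCategory (ModuleCat.{u} k)
  | .one => X e₁
  | .m => 0

variable {k} in
/-- The action of `truncObj` on morphisms. -/
noncomputable def truncMap {X Y : TM k} (f : X ⟶ Y) : ∀ j, truncObj X j ⟶ truncObj Y j
  | .one => f e₁
  | .m => 0

variable {k} in
/-- The projection of an object to its truncation. -/
noncomputable def toTrunc (X : TM k) : ∀ j : TwoMonoid, X (Additive.ofMul j) ⟶ truncObj X j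
  | .one => 𝟙 _
  | .m => 0

/-- The projection to the component of index `1`, as an endofunctor of `TM k`. -/
noncomputable def truncFunctor : TM k ⥤ TM k where
  obj X := fun j => truncObj X j.toMul
  map f := fun j => truncMap f j.toMul
  map_id _ := funext fun j => match j with
    | .one => rfl
    | .m => (isZero_zero _).eq_of_src _ _
  map_comp _ _ := funext fun j => match j with
    | .one => rfl
    | .m => (isZero_zero _).eq_of_src _ _

/-- The natural projection to the truncation. -/
noncomputable def truncUnit : 𝟭 (TM k) ⟶ truncFunctor k where
  app X := fun j => toTrunc X j.toMul
  naturality _ _ _ := funext fun j => match j with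
    | .one => (Category.comp_id _).trans (Category.id_comp _).symm
    | .m => (isZero_zero _).eq_of_tgt _ _

/-- The projection to the component of index `1` is a localization away from `loc(k_m)`. -/
noncomputable def truncLocalization : LocalizationAway (loc.{u} (kObj k .m)) where
  L := truncFunctor k
  η := truncUnit k
  isLocal X Y hY f := by
    rw [loc_kObj_m_eq] at hY
    exact funext fun j => match j with
      | .one => IsZero.eq_of_src hY _ _
      | .m => (isZero_zero _).eq_of_tgt _ _
  exists_triangle X := by
    obtain ⟨F, i, δ, h⟩ := distinguished_cocone_triangle₁ ((truncUnit k).app X)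
    refine ⟨F, ?_, i, δ, h⟩
    rw [loc_kObj_m_eq]
    -- In component `1` the unit is the identity, so the fibre `F` vanishes there, which is
    -- membership in `loc(k_m)`.
    exact (LevelwiseTriangulated.component _ e₁).isZero₁_of_isIso₂ (h e₁)
      (inferInstanceAs (IsIso (𝟙 (X e₁))))

variable {k} (ℒ : LocalizationAway (loc.{u} (kObj k .m)))

/-- The fibre of `η` lies in `loc(k_m)`, so its component `1` is zero. -/
lemma LocalizationAway.isIso_η_app_one (X : TM k) : IsIso (ℒ.η.app X e₁) := by
  obtain ⟨F, hF, i, δ, h⟩ := ℒ.exists_triangle X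
  rw [loc_kObj_m_eq] at hF
  exact ((LevelwiseTriangulated.component _ e₁).isZero₁_iff_isIso₂ (h e₁)).1 hF

/-- The component `m` of `L X`, placed alone in index `m`, belongs to `loc(k_m)`. Locality kills its
inclusion into `L X`, and hence its identity. -/
lemma LocalizationAway.isZero_obj_m (X : TM k) : IsZero (ℒ.L.obj X eₘ) := by
  rw [IsZero.iff_id_eq_zero]
  refine eq_zero_of_singleDesc_eq_zero (ℒ.isLocal X _ ?_ (singleDesc (𝟙 _)))
  exact (loc_kObj_m_iff k _).2 (isZero_single_apply _ _ (fun h => nomatch h))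

/-- The component of index `1` of a localization away from `loc(k_m)`. -/
noncomputable def LocalizationAway.compEvalIso :
    GradedObject.eval (e₁ : Additive TwoMonoid) ≅
      ℒ.L ⋙ GradedObject.eval (e₁ : Additive TwoMonoid) :=
  NatIso.ofComponents
    (fun X => @asIso _ _ _ _ (ℒ.η.app X e₁) (ℒ.isIso_η_app_one X))
    (fun f => congrFun (ℒ.η.naturality f) e₁)

/-- Colimits may be checked in components: in component `1` the functor is isomorphic to evaluation,
and in component `m` it is zero. -/
lemma LocalizationAway.isSmashing : ℒ.IsSmashing := fun I => by
  have : PreservesColimitsOfShape (Discrete I)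
      (ℒ.L ⋙ GradedObject.eval (e₁ : Additive TwoMonoid)) :=
    preservesColimitsOfShape_of_natIso ℒ.compEvalIso
  exact ⟨⟨fun hc => ⟨isColimitOfEval _ fun j => match j with
    | .one => isColimitOfPreserves (ℒ.L ⋙ GradedObject.eval (e₁ : Additive TwoMonoid)) hc
    | .m =>
      { desc := fun _ => 0
        fac := fun _ _ => (ℒ.isZero_obj_m _).eq_of_src _ _
        uniq := fun _ _ _ => (ℒ.isZero_obj_m _).eq_of_src _ _ }⟩⟩⟩

/-- Since `L` kills `k_m` and there are no zero divisors, `E` would be zero, and then `L` would also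
kill `k_1`. -/
lemma LocalizationAway.not_iso_tensorLeft (E : TM k) : IsEmpty (ℒ.L ≅ tensorLeft E) := ⟨fun e => by
  have h₁ : IsZero (ℒ.L.obj (kObj k .m)) := (tm_isZero_iff _).2
    ⟨(isZero_kObj_m_one k).of_iso (ℒ.compEvalIso.app _).symm, ℒ.isZero_obj_m _⟩
  have hE : IsZero E := ((tm_isZero_tensor_iff E _).1 (h₁.of_iso (e.app _).symm)).resolve_right
    (not_isZero_kObj k .m)
  have h₂ : IsZero (ℒ.L.obj (kObj k .one)) :=
    IsZero.of_iso ((tm_isZero_tensor_iff E _).2 (Or.inl hE)) (e.app _)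
  exact not_isZero_kObj_one_one k (((tm_isZero_iff _).1 h₂).1.of_iso
    (ℒ.compEvalIso.app (kObj k .one)))⟩

end

theorem mainTheorem4 (k : Type u) [Field k] [HasDerivedCategory.{w} (ModuleCat.{u} k)] :
    -- the unit object is `k_1`, and `k_m ⊗ k_m ≅ k_m`
    (Nonempty (𝟙_ (TM k) ≅ kObj k .one) ∧
      Nonempty (kObj k .m ⊗ kObj k .m ≅ kObj k .m)) ∧
    -- the Bousfield lattice consists of exactly two elements, the classes of `0` and of `k_1`
    (Set.range (bousfieldClass (T := TM k)) = {bousfieldClass 0, bousfieldClass (kObj k .one)} ∧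
      bousfieldClass (0 : TM k) ≠ bousfieldClass (kObj k .one) ∧
      Nonempty (BousfieldLattice (TM k) ≃o Bool)) ∧
    -- `loc(k_m)` is a nonzero proper localizing tensor ideal, and not a Bousfield class
    (IsLocalizing.{u} (loc.{u} (kObj k .m)) ∧
      IsTensorIdeal (loc.{u} (kObj k .m)) ∧
      (∃ X : TM k, loc.{u} (kObj k .m) X ∧ ¬ IsZero X) ∧
      (∃ X : TM k, ¬ loc.{u} (kObj k .m) X) ∧
      ∀ X : TM k, bousfieldClass X ≠ loc.{u} (kObj k .m)) ∧
    -- `T_M` is compactly generated, but not rigidly: some compact object is not rigid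
    (IsCompactlyGeneratedTriangulated.{u} (TM k) ∧
      (∃ X : TM k, IsCompactObject.{u} X ∧ ¬ IsDualizable X) ∧
      ¬ IsRigidlyCompactlyGenerated.{u} (TM k)) ∧
    -- the localization away from `loc(k_m)`, `k_m` compact, exists and is smashing; its functor
    -- is the projection to the component of index `1` and not of the form `E ⊗ -`
    (IsCompactObject.{u} (kObj k .m) ∧
      Nonempty (LocalizationAway (loc.{u} (kObj k .m))) ∧
      ∀ ℒ : LocalizationAway (loc.{u} (kObj k .m)),
        ℒ.IsSmashing ∧
        (∀ X : TM k, IsIso (ℒ.η.app X (Additive.ofMul .one)) ∧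
          IsZero (ℒ.L.obj X (Additive.ofMul .m))) ∧
        ¬ ∃ E : TM k, Nonempty (ℒ.L ≅ tensorLeft E)) := by
  refine ⟨⟨⟨tmUnitIso k⟩, nonempty_kObj_m_tensor_iso k⟩,
    ⟨range_bousfieldClass k, bousfieldClass_zero_ne k, nonempty_bousfieldLattice_orderIso k⟩,
    ⟨?_, ?_, ?_, ?_, loc_kObj_m_ne_bousfieldClass k⟩,
    ⟨tm_isCompactlyGenerated k, ⟨_, isCompactObject_kObj k .m, not_isDualizable_kObj_m k⟩,
      fun h => ?_⟩,
    isCompactObject_kObj k .m, ⟨truncLocalization k⟩, fun ℒ =>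
      ⟨ℒ.isSmashing, fun X => ⟨ℒ.isIso_η_app_one X, ℒ.isZero_obj_m X⟩,
        fun ⟨E, ⟨e⟩⟩ => (ℒ.not_iso_tensorLeft E).false e⟩⟩
  · rw [loc_kObj_m_eq]
    exact isLocalizing_isZero_apply k _
  · rw [loc_kObj_m_eq]
    exact fun X Y hY => ⟨(tm_isZero_tensor_one_iff X Y).2 (Or.inr hY),
      (tm_isZero_tensor_one_iff Y X).2 (Or.inl hY)⟩
  · exact ⟨kObj k .m, fun _ _ h => h, not_isZero_kObj k .m⟩
  · rw [loc_kObj_m_eq]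
    exact ⟨kObj k .one, not_isZero_kObj_one_one k⟩
  · obtain ⟨Y, _, hY⟩ := h.rigid _ (isCompactObject_kObj k .m)
    exact not_isDualizable_kObj_m k ⟨Y, hY⟩
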